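/- A Turing machine $T=(Q,q_0,q_{halt},\Sigma,\delta)$ consists of a finite set of states $Q$ with an initial state $q_0$ and a halting state $q_{halt}$, a finite alphabet $\Sigma$ with at least two symbols, and a transition function $\delta:Q\times\Sigma\to Q\times\Sigma\times\{-1,0,1\}$. Its configurations are the pairs $(q,t)\in Q\times\Sigma^{\mathbb Z}$. If $q\neq q_{halt}$ and $\delta(q,t_0)=(q',t_0',\varepsilon)$, one step of the machine sends $(q,t)$ to $\Delta(q,t)=(q',t')$, where $t'$ is obtained from $t$ by replacing $t_0$ with $t_0'$ and then shifting, $t'_n=\tilde t_{n+\varepsilon}$ with $\tilde t$ the modified tape; the machine halts, with the current configuration as output, when the state is $q_{halt}$. An input is a configuration $(q_0,t)$, $t\in\Sigma^{\mathbb Z}$. The machine is reversible if the global transition function $\Delta:(Q\setminus\{q_{halt}\})\times\Sigma^{\mathbb Z}\to Q\times\Sigma^{\mathbb Z}$ is injective. **Lemma.** There exists a Turing machine $T'=(Q',q_0,q_{halt},\Sigma',\delta')$ such that: 1. $T'$ is reversible. 2. The image of the first component of $\delta'$ does not contain $q_0$. 3. $T'$ has the "restart" property: for every tape $t\in\Sigma'^{\mathbb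 Z}$, if $T'$ halts with input $(q_0,t)$, then it halts with output $(q_{halt},t)$. 4. $T'$ is universal: for every Turing machine $T$ and every input tape $t$ of $T$, the machine $T$ halts with input $t$ if and only if $T'$ halts with input $(q_0,u)$, for a tape $u\in\Sigma'^{\mathbb Z}$ that is explicit in terms of $T$ and $t$. Here "explicit" means the following. The states and symbols of $T$ are numbered in an arbitrary way, and the symbols of $T'$ in a fixed way; the symbol numbered $0$ is called blank. There is one algorithm, the same for all $T$ and $t$, that computes the symbol $u_n$ from the finite description of $T$, the position $n\in\mathbb Z$ and the symbols $t_{-r},\dots,t_r$, where $r$ is computed from the description of $T$ and $n$. Moreover, if $t$ is blank outside $\{-N,\dots,N\}$, then $u$ is blank outside $\{-N',\dots,N'\}$, where $N'$ is computed from the description of $T$ and $N$; thus finite inputs are algorithmically turned into finite inputs. -/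

import Mathlib

/-- A Turing machine: a finite set of states with an initial and a halting state, a finite alphabet
with at least two symbols, and a transition function `δ : Q × Σ → Q × Σ × {-1, 0, 1}`.
The values of `δ` at the halting state are never used by the dynamics. -/
structure TuringMachine where
  State : Type
  Symbol : Type
  [finState : Finite State]
  [finSymbol : Finite Symbol]
  [nontrivialSymbol : Nontrivial Symbol]
  start : State
  halt : State
  δ : State → Symbol → State × Symbol × SignType

namespace TuringMachine

/-- Tapes of `M`: bi-infinite sequences of symbols; the head always reads position `0`. -/
abbrev Tape (M : TuringMachine) : Type := ℤ → M.Symbol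

/-- Configurations `(q, t)` of `M`. -/
abbrev Config (M : TuringMachine) : Type := M.State × M.Tape

/-- The global transition function, defined on the non-halting configurations: write the new symbol
at position `0`, then shift the tape by `ε`, where `ε = 1` is the left shift. -/
def globalTransition (M : TuringMachine) (c : {c : M.Config // c.1 ≠ M.halt}) : M.Config :=
  let a := M.δ c.1.1 (c.1.2 0)
  (a.1, fun n => Function.update c.1.2 0 a.2.1 (n + (a.2.2 : ℤ)))

open Classical in
/-- One step of the algorithm; no step is made from a halting configuration. -/
noncomputable def step (M : TuringMachine) (c : M.Config) : Option M.Config :=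
  if h : c.1 ≠ M.halt then some (M.globalTransition ⟨c, h⟩) else none

/-- `M`, run on the input `(q₀, t)`, halts with the final configuration `c`. -/
def HaltsWith (M : TuringMachine) (t : M.Tape) (c : M.Config) : Prop :=
  c ∈ StateTransition.eval M.step (M.start, t)

/-- `M` halts on the input `(q₀, t)`. -/
def Halts (M : TuringMachine) (t : M.Tape) : Prop :=
  ∃ c, M.HaltsWith t c

/-- `M` is reversible: its global transition function is injective. -/
def Reversible (M : TuringMachine) : Prop :=
  Function.Injective M.globalTransition

/-- The restart property: whenever `M` halts on the input `(q₀, t)`, it halts with the output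
`(q_halt, t)`. -/
def Restart (M : TuringMachine) : Prop :=
  ∀ t : M.Tape, M.Halts t → M.HaltsWith t (M.halt, t)

/-- Finite descriptions of Turing machines: number of states, number of symbols, initial state,
halting state, and the list of all quintuples `(q, s, q', s', ε)` with `δ(q, s) = (q', s', ε)`. -/
abbrev Description : Type := ℕ × ℕ × ℕ × ℕ × List (ℕ × ℕ × ℕ × ℕ × ℤ)

/-- The description of `M` with respect to a numbering of its states and of its symbols. -/
def description (M : TuringMachine) {k m : ℕ} (eQ : M.State ≃ Fin k) (eS : M.Symbol ≃ Fin m) :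
    Description :=
  (k, m, eQ M.start, eQ M.halt,
    (List.finRange k).flatMap fun i => (List.finRange m).map fun j =>
      let a := M.δ (eQ.symm i) (eS.symm j)
      ((i : ℕ), (j : ℕ), (eQ a.1 : ℕ), (eS a.2.1 : ℕ), (a.2.2 : ℤ)))

/-- The numbers of the symbols at the positions `-r, …, r` of a tape. -/
def window {M : TuringMachine} {m : ℕ} (eS : M.Symbol ≃ Fin m) (t : M.Tape) (r : ℕ) : List ℕ :=
  (List.range (2 * r + 1)).map fun j => (eS (t ((j : ℤ) - r)) : ℕ)

/-- All positions of the tape outside `-N, …, N` carry the blank symbol, the one numbered `0`. -/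
def BlankOutside {M : TuringMachine} {m : ℕ} (eS : M.Symbol ≃ Fin m) (t : M.Tape) (N : ℕ) : Prop :=
  ∀ i : ℤ, (N : ℤ) < |i| → (eS (t i) : ℕ) = 0

/-- `U` is universal: the halting of an arbitrary machine `T` on an arbitrary input tape `t` is
equivalent to the halting of `U` on an input tape `u` that is given explicitly in terms of `T` and
`t`. Explicit means: by one algorithm for all `T` and `t`, the symbol `u n` is computed (by `f`) from
the description of `T`, the position `n` and the symbols of `t` at the positions `-r, …, r`, where
`r` is itself computed from the description of `T` and `n`; and if `t` is blank outside `-N, …, N`,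
then `u` is blank outside `-N', …, N'`, where `N'` is computed (by `s`) from the description of `T`
and `N`. So a finite input is turned by an algorithm into a finite input. -/
def Universal (U : TuringMachine) : Prop :=
  ∃ (l : ℕ) (eU : U.Symbol ≃ Fin l)
    (r : Description × ℤ → ℕ) (f : Description × ℤ × List ℕ → ℕ) (s : Description × ℕ → ℕ),
    Computable r ∧ Computable f ∧ Computable s ∧
    ∀ (T : TuringMachine) (k m : ℕ) (eQ : T.State ≃ Fin k) (eS : T.Symbol ≃ Fin m) (t : T.Tape),
      ∃ u : U.Tape,
        (∀ n : ℤ, (eU (u n) : ℕ) =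
          f (T.description eQ eS, n, window eS t (r (T.description eQ eS, n)))) ∧
        (∀ N : ℕ, BlankOutside eS t N → BlankOutside eU u (s (T.description eQ eS, N))) ∧
        (T.Halts t ↔ U.Halts u)

end TuringMachine

/-! Reversibility and restart come from one construction. Let a finite local rule be partial,
injective, never entering `start`, undefined at `halt`, and let the direction of a move depend only
on the state entered. Sending `halt` to `start` keeps the rule injective, and by finiteness it
extends to a permutation `σ` of states times symbols. The machine `forwardBackward` runs `σ` until
`halt`, flips a Boolean flag and runs `σ⁻¹` until `start`: a halting run thus ends on its own input
tape. Everything then reduces to a universal computation by such a rule (`exists_restart_machine`).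

The rule (`HistorySim.rule`) simulates an arbitrary one-sided machine. After each simulated step the
head walks to a front on the right of the work area, stores there the data the step destroyed, and
moves the front one cell further. Nothing is lost, hence `rule_injective`.

The tape `t` of `T` may be infinite and nowhere blank, so no finite program contains it. The input
`u` is therefore a sequence of blocks. Block `j` knows only the cells `-j, …, j` of `t`. It is one
blank cell if `j > 0` and `t` is blank at `-j` and `j`. Otherwise it is an order to halt, if `T`
halts within `j` steps on these cells, or else a program that searches for the halting time of `T`
on these cells surrounded by blanks. A front that meets a nonblank block abandons its program and
launches that block.

If `T` halts in `s` steps, either a nonblank block `j ≥ s` exists and orders to halt, or only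
finitely many blocks are nonblank and the last of them sees all of `t`, so that its program halts
unless it is itself an order to halt (`exists_halting_block`). Conversely, a program must not halt
on account of blanks that are not really on `t`. Its output `haltingWitness` is exponential in the
halting time `s` found, and writing it takes more than `s` steps. Every simulated step has passed
one more blank block, so by then all cells that `T` can visit in `s` steps are known to agree with
`t` (`progRun_ne_none_of_not_halts`). -/

open Relation

/-! ### Partial injective local rules and permutations -/

/-- The dynamics of a local rule `F` in absolute coordinates: the head is at position `p` of a tape
that does not move, and `dir s` is the direction of every move that enters the state `s`. -/
def AbsStep {S C : Type} (F : S → C → Option (S × C)) (dir : S → SignType)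
    (x y : S × ℤ × (ℤ → C)) : Prop :=
  ∃ s c, F x.1 (x.2.2 x.2.1) = some (s, c) ∧
    y = (s, x.2.1 + (dir s : ℤ), Function.update x.2.2 x.2.1 c)

/-- A partial injective rule that is undefined at `halt` and never enters `start` extends to a
permutation that sends `halt` to `start`. -/
theorem exists_perm_extending_rule {S C : Type} [Finite S] [Finite C]
    (F : S → C → Option (S × C)) (start halt : S)
    (hinj : ∀ s c s' c' x, F s c = some x → F s' c' = some x → s = s' ∧ c = c')
    (hstart : ∀ s c c', F s c ≠ some (start, c')) (hhalt : ∀ c, F halt c = none) :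
    ∃ σ : Equiv.Perm (S × C), (∀ c, σ (halt, c) = (start, c)) ∧
      ∀ s c x, F s c = some x → σ (s, c) = x := by
  classical
  have := Fintype.ofFinite S
  have := Fintype.ofFinite C
  let G : S × C → S × C := fun x => if x.1 = halt then (start, x.2) else (F x.1 x.2).getD x
  let D : Set (S × C) := {x | x.1 = halt ∨ ∃ y, F x.1 x.2 = some y}
  -- The two clauses of `G` cannot collide, because `F` never enters `start`. An injection defined
  -- on part of a finite set then extends to a permutation.
  have hG : Set.InjOn G D := by
    rintro ⟨s, c⟩ h ⟨s', c'⟩ h' e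
    by_cases hs : s = halt <;> by_cases hs' : s' = halt
    · simp_all [G]
    · obtain h' | ⟨y, h'⟩ := h'
      · exact absurd h' hs'
      · simp only [G, hs, hs', h', if_true, if_false, Option.getD_some] at e
        exact absurd (h'.trans (by rw [← e])) (hstart _ _ c)
    · obtain h | ⟨y, h⟩ := h
      · exact absurd h hs
      · simp only [G, hs, hs', h, if_true, if_false, Option.getD_some] at e
        exact absurd (h.trans (by rw [e])) (hstart _ _ c')
    · obtain h | ⟨y, h⟩ := h
      · exact absurd h hs
      obtain h' | ⟨y', h'⟩ := h'
      · exact absurd h' hs'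
      simp only [G, hs, hs', h, h', if_false, Option.getD_some] at e
      subst e
      obtain ⟨rfl, rfl⟩ := hinj _ _ _ _ _ h h'
      rfl
  obtain ⟨g, hg⟩ := Set.MapsTo.exists_equiv_extend_of_card_eq (t := (Finset.univ : Finset (S × C)))
    (by simp) (s := D) (f := G) (fun _ _ => by simp) hG
  let σ : Equiv.Perm (S × C) := g.trans (Equiv.subtypeUnivEquiv (by simp))
  have hσ : ∀ x ∈ D, σ x = G x := fun x hx => hg x hx
  refine ⟨σ, fun c => ?_, fun s c x h => ?_⟩
  · rw [hσ _ (Or.inl rfl)]; simp [G]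
  · rw [hσ _ (Or.inr ⟨x, h⟩)]
    have : s ≠ halt := by rintro rfl; simp [hhalt] at h
    simp [G, this, h]

/-! ### The reversible machine that runs forward and then backward -/

namespace TuringMachine

/-- A machine whose moves are determined by the state they enter and whose local rule is injective
is reversible. -/
theorem reversible_of_injective (M : TuringMachine) (d : M.State → SignType)
    (hd : ∀ q a, q ≠ M.halt → (M.δ q a).2.2 = d (M.δ q a).1)
    (hinj : ∀ q a q' a', q ≠ M.halt → q' ≠ M.halt → (M.δ q a).1 = (M.δ q' a').1 →
      (M.δ q a).2.1 = (M.δ q' a').2.1 → q = q' ∧ a = a') : M.Reversible := by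
  rintro ⟨⟨q, t⟩, hq⟩ ⟨⟨q', t'⟩, hq'⟩ h
  simp only [globalTransition, Prod.mk.injEq] at h hq hq'
  obtain ⟨h1, h2⟩ := h
  -- The entered state is visible in the image and fixes the shift, so both tapes were shifted by
  -- the same amount.
  rw [hd _ _ hq, hd _ _ hq', h1] at h2
  set e : ℤ := (d (M.δ q' (t' 0)).1 : ℤ)
  have h3 : ∀ n, Function.update t 0 (M.δ q (t 0)).2.1 n =
      Function.update t' 0 (M.δ q' (t' 0)).2.1 n := fun n => by
    have := congrFun h2 (n - e)
    simpa using this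
  obtain ⟨rfl, h0⟩ := hinj _ _ _ _ hq hq' h1 (by simpa using h3 0)
  have : t = t' := by
    funext n
    by_cases hn : n = 0
    · rw [hn, h0]
    · simpa [hn] using h3 n
  subst this
  rfl

theorem step_of_ne (M : TuringMachine) {q : M.State} (h : q ≠ M.halt) (t : M.Tape) :
    M.step (q, t) = some ((M.δ q (t 0)).1,
      fun n => Function.update t 0 (M.δ q (t 0)).2.1 (n + ((M.δ q (t 0)).2.2 : ℤ))) := by
  simp [step, h, globalTransition]

theorem step_halt (M : TuringMachine) (t : M.Tape) : M.step (M.halt, t) = none := by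
  simp [step]

theorem step_eq_none (M : TuringMachine) {c : M.Config} (h : M.step c = none) : c.1 = M.halt := by
  by_contra h'
  simp [step, h'] at h

section ForwardBackward

variable {S C : Type}

open Classical in
/-- The machine that runs a permutation of local states forward from `start` to `halt`, and then
backward to `start`. The Boolean component of a state says whether the machine runs forward. -/
noncomputable abbrev forwardBackward [Finite S] [Finite C] [Nontrivial C] (σ : Equiv.Perm (S × C)) (start halt : S)
    (dir : S → SignType) : TuringMachine where
  State := S × Bool
  Symbol := C
  start := (start, true)
  halt := (start, false)
  δ q c :=
    if q.2 then
      if q.1 = halt then ((halt, false), c, -dir halt)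
      else (((σ (q.1, c)).1, true), (σ (q.1, c)).2, dir (σ (q.1, c)).1)
    else
      if q.1 = start then ((start, false), c, 0)
      else (((σ.symm (q.1, c)).1, false), (σ.symm (q.1, c)).2, -dir (σ.symm (q.1, c)).1)

variable {σ : Equiv.Perm (S × C)} {start halt : S} {dir : S → SignType}

/-- The pairs with state `halt` already fill all pairs with state `start`, so injectivity of `σ`
leaves no room for other preimages. -/
theorem perm_fst_ne_start (hσ : ∀ c, σ (halt, c) = (start, c)) {s : S} (hs : s ≠ halt) (c : C) :
    (σ (s, c)).1 ≠ start := by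
  intro h
  have h1 : σ (s, c) = σ (halt, (σ (s, c)).2) := by rw [hσ, ← h]
  exact hs (congrArg Prod.fst (σ.injective h1))

theorem perm_symm_fst_ne_halt (hσ : ∀ c, σ (halt, c) = (start, c)) {s : S} (hs : s ≠ start)
    (c : C) : (σ.symm (s, c)).1 ≠ halt := by
  intro h
  have h1 : (s, c) = σ (halt, (σ.symm (s, c)).2) := by rw [← h]; simp
  rw [hσ] at h1
  exact hs (congrArg Prod.fst h1)

variable [Finite S] [Finite C] [Nontrivial C]

/-- Forward steps apply `σ` and backward steps `σ⁻¹`, both injective. The only step that changes the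
flag is the turn; it enters `(halt, false)`, which no backward step enters since `σ⁻¹` reaches
`halt` from `start` only. The turn moves by `-dir halt`, so that the direction still depends on the
entered state alone. -/
theorem forwardBackward_reversible (hσ : ∀ c, σ (halt, c) = (start, c)) :
    (forwardBackward σ start halt dir).Reversible := by
  refine reversible_of_injective _ (fun q => if q.2 then dir q.1 else -dir q.1) ?_ ?_
  · rintro ⟨s, b⟩ a h
    simp only [ne_eq, Prod.mk.injEq, not_and] at h
    cases b
    · have hs : s ≠ start := fun e => by simpa using h e
      simp [hs]
    · by_cases hs : s = halt <;> simp [hs]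
  · rintro ⟨s, b⟩ a ⟨s', b'⟩ a' h h' e1 e2
    simp only [ne_eq, Prod.mk.injEq, not_and] at h h'
    cases b <;> cases b'
    · simp only [imp_false, not_true] at h h'
      simp only [Bool.false_eq_true, if_false, h, h', Prod.mk.injEq, and_true] at e1 e2
      have := σ.symm.injective (Prod.ext e1 e2)
      simpa using this
    · simp only [not_true, imp_false] at h
      by_cases hs' : s' = halt
      · simp only [Bool.false_eq_true, if_false, h, hs', if_true, Prod.mk.injEq, and_true] at e1
        exact absurd e1 (perm_symm_fst_ne_halt hσ h _)
      · simp [h, hs'] at e1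
    · simp only [not_true, imp_false] at h'
      by_cases hs : s = halt
      · simp only [Bool.false_eq_true, if_false, h', hs, if_true, Prod.mk.injEq, and_true] at e1
        exact absurd e1.symm (perm_symm_fst_ne_halt hσ h' _)
      · simp [h', hs] at e1
    · by_cases hs : s = halt <;> by_cases hs' : s' = halt
      · simp_all
      · simp [hs, hs'] at e1
      · simp [hs, hs'] at e1
      · simp only [if_true, hs, hs', if_false, Prod.mk.injEq, and_true] at e1 e2
        have := σ.injective (Prod.ext e1 e2)
        simpa using this

theorem forwardBackward_fst_ne_start (hσ : ∀ c, σ (halt, c) = (start, c)) (q : S × Bool) (a : C) :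
    ((forwardBackward σ start halt dir).δ q a).1 ≠ (start, true) := by
  obtain ⟨s, b⟩ := q
  cases b
  · by_cases hs : s = start <;> simp [hs]
  · by_cases hs : s = halt
    · simp [hs]
    · simpa [hs] using perm_fst_ne_start hσ hs a

theorem forwardBackward_step_forward {s : S} (hs : s ≠ halt) (t : ℤ → C) :
    (forwardBackward σ start halt dir).step ((s, true), t) =
      some (((σ (s, t 0)).1, true), fun n =>
        Function.update t 0 (σ (s, t 0)).2 (n + (dir (σ (s, t 0)).1 : ℤ))) := by
  rw [step_of_ne _ (by simp)]
  simp [hs]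

theorem forwardBackward_step_turn (t : ℤ → C) :
    (forwardBackward σ start halt dir).step ((halt, true), t) =
      some ((halt, false), fun n => t (n - (dir halt : ℤ))) := by
  rw [step_of_ne _ (by simp)]
  simp [sub_eq_add_neg]

theorem forwardBackward_step_backward {s : S} (hs : s ≠ start) (t : ℤ → C) :
    (forwardBackward σ start halt dir).step ((s, false), t) =
      some (((σ.symm (s, t 0)).1, false), fun n =>
        Function.update t 0 (σ.symm (s, t 0)).2 (n - (dir (σ.symm (s, t 0)).1 : ℤ))) := by
  rw [step_of_ne _ (by simp [hs])]
  simp [hs, sub_eq_add_neg]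

/-- From every configuration reached on the input `t`, the machine can be run back to `t`. -/
theorem forwardBackward_reaches_back (hσ : ∀ c, σ (halt, c) = (start, c)) (hdir : dir start = 0)
    (t : ℤ → C) {c : (S × Bool) × (ℤ → C)}
    (h : StateTransition.Reaches (forwardBackward σ start halt dir).step ((start, true), t) c) :
    (c.1.2 = true → StateTransition.Reaches (forwardBackward σ start halt dir).step
      ((c.1.1, false), fun n => c.2 (n - (dir c.1.1 : ℤ))) ((start, false), t)) ∧
    (c.1.2 = false → StateTransition.Reaches (forwardBackward σ start halt dir).step
      c ((start, false), t)) := by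
  induction h with
  | refl => exact ⟨fun _ => by simp only [hdir, SignType.coe_zero, sub_zero]; exact ReflTransGen.refl, by simp⟩
  | tail _ hc ih =>
    rename_i c c' _
    obtain ⟨⟨s, b⟩, w⟩ := c
    cases b
    · by_cases hs : s = start
      · subst hs
        have := step_halt (forwardBackward σ s halt dir) w
        rw [Option.mem_def] at hc
        exact absurd (hc.symm.trans this) (by simp)
      have hstep := forwardBackward_step_backward (σ := σ) (halt := halt) (dir := dir) hs w
      have hc' := Option.some.inj ((Option.mem_def.1 hc).symm.trans hstep)
      refine ⟨fun h => ?_, fun _ => ?_⟩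
      · rw [hc'] at h
        simp at h
      · have hr := ih.2 rfl
        -- Steps are deterministic, so the known path to the final configuration begins with the
        -- step just made.
        rcases ReflTransGen.cases_head hr with he | ⟨d, hd, hr'⟩
        · simp only [Prod.mk.injEq] at he
          exact absurd he.1.1 hs
        · cases Option.mem_unique hd hc
          exact hr'
    · by_cases hs : s = halt
      · subst hs
        have hstep := forwardBackward_step_turn (σ := σ) (start := start) (halt := s) (dir := dir) w
        have hc' := Option.some.inj ((Option.mem_def.1 hc).symm.trans hstep)
        subst hc'
        exact ⟨by simp, fun _ => ih.1 rfl⟩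
      · have hstep := forwardBackward_step_forward (σ := σ) (start := start) (dir := dir) hs w
        have hc' := Option.some.inj ((Option.mem_def.1 hc).symm.trans hstep)
        subst hc'
        refine ⟨fun _ => ?_, by simp⟩
        -- Shifting back by `dir` of the entered state puts the head on the cell just rewritten,
        -- where `σ.symm` restores both state and symbol.
        refine ReflTransGen.head (Option.mem_def.2
          (forwardBackward_step_backward (perm_fst_ne_start hσ hs _) _)) ?_
        simp only [sub_add_cancel, Function.update_self, Prod.mk.eta, Equiv.symm_apply_apply,
          Function.update_idem, Function.update_eq_self]
        exact ih.1 rfl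

/-- A final configuration carries the flag `false`, hence leads to `(start, false)` on the tape `t`,
which is itself final. -/
theorem forwardBackward_restart (hσ : ∀ c, σ (halt, c) = (start, c)) (hdir : dir start = 0) :
    (forwardBackward σ start halt dir).Restart := by
  rintro t ⟨c, hc⟩
  obtain ⟨hr, hn⟩ := StateTransition.mem_eval.1 hc
  have hc1 : c.1 = (start, false) := step_eq_none _ hn
  have hback := (forwardBackward_reaches_back hσ hdir t hr).2 (by rw [hc1])
  exact StateTransition.mem_eval.2 ⟨hr.trans hback, step_halt _ _⟩

/-- The tape as seen from the head of an absolute configuration. -/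
def relative (x : S × ℤ × (ℤ → C)) : (S × Bool) × (ℤ → C) := ((x.1, true), fun n => x.2.2 (n + x.2.1))

variable {F : S → C → Option (S × C)}

theorem forwardBackward_step_of_absStep (hF : ∀ s c x, F s c = some x → σ (s, c) = x)
    (hhalt : ∀ c, F halt c = none) {x y : S × ℤ × (ℤ → C)} (h : AbsStep F dir x y) :
    (forwardBackward σ start halt dir).step (relative x) = some (relative y) := by
  obtain ⟨s, p, τ⟩ := x
  obtain ⟨s', c', h, rfl⟩ := h
  have hs : s ≠ halt := by rintro rfl; simp [hhalt] at h
  rw [relative, forwardBackward_step_forward hs]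
  have := hF _ _ _ h
  simp only [zero_add]
  rw [this]
  simp only [relative, Option.some.injEq, Prod.mk.injEq, true_and]
  funext n
  simp only [Function.update_apply]
  have : n + (dir s' : ℤ) = 0 ↔ n + (p + (dir s' : ℤ)) = p := by omega
  simp only [this]
  congr 2
  ring

theorem forwardBackward_halts (hσ : ∀ c, σ (halt, c) = (start, c)) (hdir : dir start = 0)
    (hF : ∀ s c x, F s c = some x → σ (s, c) = x) (hhalt : ∀ c, F halt c = none)
    {t : ℤ → C} {y : S × ℤ × (ℤ → C)} (h : ReflTransGen (AbsStep F dir) (start, 0, t) y)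
    (hy : y.1 = halt) : (forwardBackward σ start halt dir).Halts t := by
  have h1 : StateTransition.Reaches (forwardBackward σ start halt dir).step
      ((start, true), t) (relative y) := by
    have := ReflTransGen.lift (p := fun a b => b ∈ (forwardBackward σ start halt dir).step a)
      relative (fun a b hab => forwardBackward_step_of_absStep hF hhalt hab) _ _ h
    simpa only [StateTransition.Reaches, Function.onFun, relative, add_zero] using this
  obtain ⟨s, p, τ⟩ := y
  obtain rfl : s = halt := hy
  have h2 := h1.tail (Option.mem_def.2 (forwardBackward_step_turn _))
  exact ⟨_, StateTransition.mem_eval.2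
    ⟨h2.trans ((forwardBackward_reaches_back hσ hdir t h2).2 rfl), step_halt _ _⟩⟩

/-- One passage within `I` may take many machine steps. The property kept along the run is therefore
that every reached configuration, also between two points of `I`, has a nonempty path into `I`; a
final configuration has none. -/
theorem forwardBackward_not_halts (hF : ∀ s c x, F s c = some x → σ (s, c) = x)
    (hhalt : ∀ c, F halt c = none) {t : ℤ → C} (I : Set (S × ℤ × (ℤ → C)))
    (hI : ∀ x ∈ I, ∃ y ∈ I, TransGen (AbsStep F dir) x y) (ht : (start, 0, t) ∈ I) :
    ¬ (forwardBackward σ start halt dir).Halts t := by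
  rintro ⟨c, hc⟩
  obtain ⟨hr, hn⟩ := StateTransition.mem_eval.1 hc
  set f := (forwardBackward σ start halt dir).step
  have hI' : ∀ x ∈ I, ∃ y ∈ I, StateTransition.Reaches₁ f (relative x) (relative y) := fun x hx =>
    let ⟨y, hy, hxy⟩ := hI x hx
    ⟨y, hy, TransGen.lift relative
      (fun _ _ hab => forwardBackward_step_of_absStep hF hhalt hab) _ _ hxy⟩
  have hc' : ∃ y ∈ I, StateTransition.Reaches₁ f c (relative y) := by
    clear hn hc
    induction hr with
    | refl =>
      obtain ⟨y, hy, h⟩ := hI' _ ht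
      exact ⟨y, hy, by simpa only [relative, add_zero] using h⟩
    | tail _ hstep ih =>
      obtain ⟨y, hy, h⟩ := ih
      obtain ⟨z, hz, hzy⟩ := TransGen.head'_iff.1 h
      cases Option.mem_unique hstep hz
      rcases ReflTransGen.cases_head hzy with rfl | ⟨w, hw, hwy⟩
      · exact hI' _ hy
      · exact ⟨y, hy, TransGen.head' hw hwy⟩
  obtain ⟨y, -, h⟩ := hc'
  obtain ⟨z, hz, -⟩ := TransGen.head'_iff.1 h
  rw [Option.mem_def, hn] at hz
  cases hz

end ForwardBackward

/-- Every partial injective local rule gives rise to a reversible machine with the restart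
property. -/
theorem exists_restart_machine {S C : Type} [Finite S] [Finite C] [Nontrivial C]
    (F : S → C → Option (S × C)) (dir : S → SignType) (start halt : S)
    (hinj : ∀ s c s' c' x, F s c = some x → F s' c' = some x → s = s' ∧ c = c')
    (hstart : ∀ s c c', F s c ≠ some (start, c')) (hhalt : ∀ c, F halt c = none)
    (hdir : dir start = 0) :
    ∃ M : TuringMachine, M.Reversible ∧ (∀ q a, (M.δ q a).1 ≠ M.start) ∧ M.Restart ∧
      ∃ e : M.Symbol ≃ C, ∀ t : ℤ → C,
        ((∃ y, ReflTransGen (AbsStep F dir) (start, 0, t) y ∧ y.1 = halt) →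
          M.Halts fun n => e.symm (t n)) ∧
        ∀ I : Set (S × ℤ × (ℤ → C)), (∀ x ∈ I, ∃ y ∈ I, TransGen (AbsStep F dir) x y) →
          (start, 0, t) ∈ I → ¬ M.Halts fun n => e.symm (t n) := by
  obtain ⟨σ, hσ, hF⟩ := exists_perm_extending_rule F start halt hinj hstart hhalt
  exact ⟨forwardBackward σ start halt dir, forwardBackward_reversible hσ,
    forwardBackward_fst_ne_start hσ, forwardBackward_restart hσ hdir, Equiv.refl C, fun t =>
      ⟨fun ⟨_, hy, hy'⟩ => forwardBackward_halts hσ hdir hF hhalt hy hy',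
        fun I hI ht => forwardBackward_not_halts hF hhalt I hI ht⟩⟩

end TuringMachine

/-! ### The reversible simulation with a history -/

namespace HistorySim

/-- The role of a cell in the input: an ordinary cell, the first cell of a program, or a cell that
orders to halt. -/
inductive Kind
  | plain | first | quit
  deriving DecidableEq

/-- The mark of a cell: none, the position of the simulated head, or the final state of a simulated
computation. -/
inductive Mark (K : Type)
  | none | here | final (o : Option K)

/-- The entries of the history: a launch in a given state, or a simulated step. -/
abbrev Entry (K C : Type) : Type := Option K ⊕ Option K × C × SignType

/-- The cells of the simulating machine. -/
structure Cell (K C : Type) where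
  kind : Kind
  content : C
  front : Bool
  mark : Mark K
  hist : Option (Entry K C)

/-- The states of the simulating machine. -/
inductive State (K C : Type)
  | launch (o : Option K)
  | run (o : Option K)
  | moved (k : K) (r : Option K × C × SignType)
  | toFront (k : K) (r : Option K × C × SignType)
  | back (k : K)
  | halted

variable {K C : Type}

instance : Finite Kind := Finite.of_equiv _ (proxy_equiv% Kind)

instance [Finite K] : Finite (Mark K) := Finite.of_equiv _ (proxy_equiv% (Mark K))

instance [Finite K] [Finite C] : Finite (Cell K C) :=
  Finite.of_injective (fun x => (x.kind, x.content, x.front, x.mark, x.hist)) fun x y h => by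
    cases x; cases y; simpa using h

instance [Finite K] [Finite C] : Finite (State K C) := Finite.of_equiv _ (proxy_equiv% (State K C))

/-- The direction of the moves that enter a state. -/
def State.dir : State K C → SignType
  | .launch (some _) => 1
  | .moved _ r => r.2.2
  | .toFront _ _ => 1
  | .back _ => -1
  | _ => 0

/-- The reversible simulation of the one-sided machine `D`. A simulated step is made at the mark;
the head then travels to the front, stores there the data that the step has destroyed, advances the
front by one cell and returns. A front that meets the first cell of a program launches this
program. -/
def rule (D : Option K → Bool → C → Option (K × C × SignType)) :
    State K C → Cell K C → Option (State K C × Cell K C)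
  | .launch o, x =>
    match x.kind, o with
    | .first, o => if x.hist = none then some (.run none, { x with hist := some (.inl o) }) else none
    | .quit, o =>
      if x.hist = none then
        match x.mark with
        | .none => some (.halted, { x with hist := some (.inl o) })
        | _ => none
      else none
    | .plain, some k => if x.front then none else some (.back k, { x with front := true })
    | .plain, none => none
  | .run o, x =>
    match D o (x.kind = .first) x.content with
    | none =>
      match x.mark with
      | .none => some (.halted, { x with mark := .final o })
      | _ => none
    | some (k, c, e) => some (.moved k (o, x.content, e), { x with content := c })
  | .moved k r, x =>
    match x.mark with
    | .none => some (.toFront k r, { x with mark := .here })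
    | _ => none
  | .toFront k r, x =>
    if x.front then
      if x.hist = none then
        some (.launch (some k), { x with front := false, hist := some (.inr r) })
      else none
    else
      match x.mark with
      | .none => some (.toFront k r, x)
      | _ => none
  | .back k, x =>
    match x.mark with
    | .here => some (.run (some k), { x with mark := .none })
    | .none => if x.front then none else some (.back k, x)
    | .final _ => none
  | .halted, _ => none

theorem rule_ne_launch_none (D : Option K → Bool → C → Option (K × C × SignType)) (s : State K C)
    (x y : Cell K C) : rule D s x ≠ some (.launch none, y) := by
  intro h
  unfold rule at h
  split at h <;> (repeat' split at h) <;> simp_all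

/-- Clauses that enter the same state leave distinguishable cells. `toFront` is entered leaving the
mark `here`, or none while travelling; `back` leaving a front, or none while travelling; `halted`
leaving a final mark, or none after a `quit` cell. Overwritten data survive in the new state, in the
history or in the final mark. -/
theorem rule_injective (D : Option K → Bool → C → Option (K × C × SignType)) (s : State K C)
    (x : Cell K C) (s' : State K C) (x' : Cell K C) (y : State K C × Cell K C)
    (h : rule D s x = some y) (h' : rule D s' x' = some y) : s = s' ∧ x = x' := by
  obtain ⟨kd, c, f, m, hi⟩ := x
  obtain ⟨kd', c', f', m', hi'⟩ := x'
  unfold rule at h h'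
  split at h <;> split at h' <;> (repeat' split at h) <;> (repeat' split at h') <;> grind

end HistorySim

/-! ### The head movements of one simulated step -/

namespace HistorySim

variable {K C : Type} {D : Option K → Bool → C → Option (K × C × SignType)}

/-- An ordinary cell with the given content and nothing else on it. -/
def plainCell (c : C) : Cell K C := ⟨.plain, c, false, .none, none⟩

/-- The simulation of a computation whose program starts at position `b`: the front is at `b + n`,
and between `b` and the front lies the one-sided tape `w`. -/
structure Running (τ : ℤ → Cell K C) (b : ℤ) (n : ℕ) (w : ℕ → C) : Prop where
  content : ∀ i ≤ n, (τ (b + i)).content = w i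
  kind : ∀ i ≤ n, (τ (b + i)).kind = if i = 0 then .first else .plain
  mark : ∀ i ≤ n, (τ (b + i)).mark = .none
  front : ∀ i ≤ n, (τ (b + i)).front = decide (i = n)
  hist : (τ (b + n)).hist = none

theorem absStep_iff {S C : Type} {F : S → C → Option (S × C)} {dir : S → SignType} {s : S} {p : ℤ}
    {τ : ℤ → C} {s' : S} {c : C} (h : F s (τ p) = some (s', c)) :
    AbsStep F dir (s, p, τ) (s', p + (dir s' : ℤ), Function.update τ p c) :=
  ⟨s', c, h, rfl⟩

theorem toFront_travel (k : K) (r : Option K × C × SignType) (τ : ℤ → Cell K C) (p : ℤ) (d : ℕ)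
    (h : ∀ i < d, (τ (p + i)).front = false ∧ (τ (p + i)).mark = .none) :
    ReflTransGen (AbsStep (rule D) State.dir) (.toFront k r, p, τ) (.toFront k r, p + d, τ) := by
  induction d with
  | zero => simpa using ReflTransGen.refl
  | succ d ih =>
    refine (ih fun i hi => h i (by omega)).tail ?_
    have := absStep_iff (F := rule D) (dir := State.dir) (s := .toFront k r) (p := p + d) (τ := τ)
      (s' := .toFront k r) (c := τ (p + d)) (by simp [rule, h d (by omega)])
    simpa [State.dir, add_assoc] using this

theorem back_travel (k : K) (τ : ℤ → Cell K C) (p : ℤ) (d : ℕ)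
    (h : ∀ i < d, (τ (p - i)).front = false ∧ (τ (p - i)).mark = .none) :
    ReflTransGen (AbsStep (rule D) State.dir) (.back k, p, τ) (.back k, p - d, τ) := by
  induction d with
  | zero => simpa using ReflTransGen.refl
  | succ d ih =>
    refine (ih fun i hi => h i (by omega)).tail ?_
    have := absStep_iff (F := rule D) (dir := State.dir) (s := .back k) (p := p - d) (τ := τ)
      (s' := .back k) (c := τ (p - d)) (by simp [rule, h d (by omega)])
    simpa [State.dir, sub_eq_add_neg, add_assoc, add_comm] using this

/-- The first half of a simulated step: the front has been erased, and the head is on the cell after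
it. -/
theorem Running.launch {τ : ℤ → Cell K C} {o : Option K} {b : ℤ} {pos n pos' : ℕ} {w : ℕ → C}
    (h : Running τ b n w) (hpos : pos < n) {k : K} {c : C} {e : SignType}
    (hD : D o (pos = 0) (w pos) = some (k, c, e)) (he : (pos' : ℤ) = pos + e) (hpos' : pos' < n) :
    ∃ τ', TransGen (AbsStep (rule D) State.dir) (.run o, b + pos, τ)
        (.launch (some k), b + n + 1, τ') ∧
      (∀ i ≤ n, (τ' (b + i)).content = Function.update w pos c i) ∧
      (∀ i ≤ n, (τ' (b + i)).kind = if i = 0 then .first else .plain) ∧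
      (∀ i ≤ n, (τ' (b + i)).mark = if i = pos' then .here else .none) ∧
      (∀ i ≤ n, (τ' (b + i)).front = false) ∧ ∀ j > b + n, τ' j = τ j := by
  -- The tapes after writing at `pos`, marking `pos'`, and replacing the front by a history entry;
  -- the walk from the mark to the front changes nothing.
  set τ₁ := Function.update τ (b + pos) { τ (b + pos) with content := c } with hτ₁
  set τ₂ := Function.update τ₁ (b + pos') { τ₁ (b + pos') with mark := .here } with hτ₂
  set τ₃ := Function.update τ₂ (b + n)
    { τ₂ (b + n) with front := false, hist := some (.inr (o, w pos, e)) } with hτ₃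
  have s₁ : AbsStep (rule D) State.dir (.run o, b + pos, τ) (.moved k (o, w pos, e), b + pos', τ₁) := by
    have := absStep_iff (F := rule D) (dir := State.dir) (s := .run o) (p := b + pos) (τ := τ)
      (s' := .moved k (o, w pos, e)) (c := { τ (b + pos) with content := c })
      (by
        have hk : (decide ((τ (b + pos)).kind = .first)) = decide (pos = 0) := by
          rw [h.kind pos hpos.le]
          by_cases h0 : pos = 0 <;> simp [h0]
        simp only [rule, hk, h.content pos hpos.le, hD])
    simpa only [State.dir, add_assoc, ← he] using this
  have s₂ : AbsStep (rule D) State.dir (.moved k (o, w pos, e), b + pos', τ₁)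
      (.toFront k (o, w pos, e), b + pos' + 1, τ₂) := by
    have := absStep_iff (F := rule D) (dir := State.dir) (s := .moved k (o, w pos, e))
      (p := b + pos') (τ := τ₁) (s' := .toFront k (o, w pos, e))
      (c := { τ₁ (b + pos') with mark := .here })
      (by
        have : (τ₁ (b + pos')).mark = .none := by
          have h1 := h.mark pos' hpos'.le
          have h2 := h.mark pos hpos.le
          rw [hτ₁, Function.update_apply]; split_ifs <;> assumption
        simp [rule, this])
    simpa [State.dir] using this
  have s₃ := toFront_travel (D := D) k (o, w pos, e) τ₂ (b + pos' + 1) (n - pos' - 1) (by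
    intro i hi
    have e1 : b + (pos' : ℤ) + 1 + i = b + (pos' + 1 + i : ℕ) := by push_cast; ring
    have h1 := h.front (pos' + 1 + i) (by omega)
    have h2 := h.mark (pos' + 1 + i) (by omega)
    rw [e1, hτ₂, Function.update_of_ne (by omega), hτ₁]
    have h3 : (τ (b + pos)).front = false := by rw [h.front pos hpos.le]; simp; omega
    have h4 := h.mark pos hpos.le
    rw [decide_eq_false (by omega)] at h1
    rw [Function.update_apply]; split_ifs <;> simp_all)
  have e2 : b + (pos' : ℤ) + 1 + (n - pos' - 1 : ℕ) = b + n := by omega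
  rw [e2] at s₃
  have e3 : τ₂ (b + n) = τ (b + n) := by
    rw [hτ₂, Function.update_of_ne (by omega), hτ₁, Function.update_of_ne (by omega)]
  have s₄ : AbsStep (rule D) State.dir (.toFront k (o, w pos, e), b + n, τ₂)
      (.launch (some k), b + n + 1, τ₃) := by
    have := absStep_iff (F := rule D) (dir := State.dir) (s := .toFront k (o, w pos, e))
      (p := b + n) (τ := τ₂) (s' := .launch (some k))
      (c := { τ₂ (b + n) with front := false, hist := some (.inr (o, w pos, e)) })
      (by simp [rule, e3, h.front n le_rfl, h.hist])
    simpa [State.dir] using this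
  have hcell : ∀ i : ℕ, τ₃ (b + i) =
      { τ (b + i) with
        content := if i = pos then c else (τ (b + i)).content
        mark := if i = pos' then .here else (τ (b + i)).mark
        front := if i = n then false else (τ (b + i)).front
        hist := if i = n then some (.inr (o, w pos, e)) else (τ (b + i)).hist } := by
    intro i
    have hn : n ≠ pos := hpos.ne'
    have hn' : n ≠ pos' := hpos'.ne'
    simp only [hτ₃, hτ₂, hτ₁, Function.update_apply, add_right_inj, Nat.cast_inj]
    by_cases h3 : i = n
    · subst h3
      simp only [hn, hn', if_true, if_false]
    · by_cases h2 : i = pos'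
      · subst h2
        by_cases h1 : i = pos
        · subst h1
          simp only [h3, if_true, if_false]
        · simp only [h3, h1, if_true, if_false]
      · by_cases h1 : i = pos
        · subst h1
          simp only [h3, h2, if_true, if_false]
        · simp only [h3, h2, h1, if_false]
  refine ⟨τ₃, (TransGen.head s₁ (TransGen.head' s₂ s₃)).tail s₄, ?_, ?_, ?_, ?_, ?_⟩
  · intro i hi
    simp only [hcell, Function.update_apply, h.content i hi]
  · intro i hi
    simp only [hcell, h.kind i hi]
  · intro i hi
    simp only [hcell, h.mark i hi]
  · intro i hi
    simp only [hcell, h.front i hi]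
    split_ifs with h1 <;> simp [h1]
  · intro j hj
    rw [hτ₃, Function.update_of_ne (by omega), hτ₂, Function.update_of_ne (by omega), hτ₁,
      Function.update_of_ne (by omega)]

/-- A simulated step whose front advances to a blank cell. -/
theorem Running.step {τ : ℤ → Cell K C} {o : Option K} {b : ℤ} {pos n pos' : ℕ} {w : ℕ → C}
    (h : Running τ b n w) (hpos : pos < n) {k : K} {c : C} {e : SignType}
    (hD : D o (pos = 0) (w pos) = some (k, c, e)) (he : (pos' : ℤ) = pos + e) (hpos' : pos' < n)
    (hblank : τ (b + n + 1) = plainCell (w (n + 1))) :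
    ∃ τ', TransGen (AbsStep (rule D) State.dir) (.run o, b + pos, τ)
        (.run (some k), b + pos', τ') ∧
      Running τ' b (n + 1) (Function.update w pos c) ∧ ∀ j > b + n + 1, τ' j = τ j := by
  obtain ⟨τ₃, s, hc, hk, hm, hf, hr⟩ := h.launch hpos hD he hpos'
  have hb : τ₃ (b + n + 1) = plainCell (w (n + 1)) := by rw [hr _ (by omega), hblank]
  set τ₄ := Function.update τ₃ (b + n + 1) { τ₃ (b + n + 1) with front := true } with hτ₄
  set τ₅ := Function.update τ₄ (b + pos') { τ₄ (b + pos') with mark := .none } with hτ₅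
  have h₄ : ∀ i : ℕ, i ≤ n → τ₄ (b + i) = τ₃ (b + i) := fun i hi => by
    rw [hτ₄, Function.update_of_ne (by omega)]
  have s₁ : AbsStep (rule D) State.dir (.launch (some k), b + n + 1, τ₃) (.back k, b + n, τ₄) := by
    have := absStep_iff (F := rule D) (dir := State.dir) (s := .launch (some k)) (p := b + n + 1)
      (τ := τ₃) (s' := .back k) (c := { τ₃ (b + n + 1) with front := true })
      (by simp [rule, hb, plainCell])
    simpa [State.dir] using this
  have s₂ := back_travel (D := D) k τ₄ (b + n) (n - pos') (by
    intro i hi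
    have e1 : b + (n : ℤ) - i = b + (n - i : ℕ) := by omega
    rw [e1, h₄ _ (by omega), hf _ (by omega), hm _ (by omega), if_neg (by omega)]
    exact ⟨rfl, rfl⟩)
  have e2 : b + (n : ℤ) - (n - pos' : ℕ) = b + pos' := by omega
  rw [e2] at s₂
  have s₃ : AbsStep (rule D) State.dir (.back k, b + pos', τ₄) (.run (some k), b + pos', τ₅) := by
    have := absStep_iff (F := rule D) (dir := State.dir) (s := .back k) (p := b + pos')
      (τ := τ₄) (s' := .run (some k)) (c := { τ₄ (b + pos') with mark := .none })
      (by simp [rule, h₄ pos' hpos'.le, hm pos' hpos'.le])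
    simpa [State.dir] using this
  have hcell : ∀ i : ℕ, i ≤ n → τ₅ (b + i) = { τ₃ (b + i) with mark := .none } := by
    intro i hi
    rw [hτ₅, Function.update_apply]
    split_ifs with h1
    · rw [h₄ _ hpos'.le, h1]
    · rw [h₄ _ hi]
      have := hm i hi
      rw [if_neg (by omega)] at this
      rw [← this]
  have hlast : τ₅ (b + (n + 1 : ℕ)) = { plainCell (w (n + 1)) with front := true } := by
    rw [hτ₅, Function.update_of_ne (by omega), hτ₄]
    push_cast
    rw [← add_assoc, Function.update_self, hb]
  refine ⟨τ₅, (s.trans (TransGen.head' s₁ s₂)).tail s₃, ⟨?_, ?_, ?_, ?_, ?_⟩, ?_⟩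
  · intro i hi
    rcases Nat.lt_succ_iff_lt_or_eq.1 (Nat.lt_succ_of_le hi) with hi | rfl
    · rw [hcell i (by omega), hc i (by omega)]
    · rw [hlast, Function.update_of_ne (by omega)]; rfl
  · intro i hi
    rcases Nat.lt_succ_iff_lt_or_eq.1 (Nat.lt_succ_of_le hi) with hi | rfl
    · rw [hcell i (by omega), hk i (by omega)]
    · rw [hlast]; rfl
  · intro i hi
    rcases Nat.lt_succ_iff_lt_or_eq.1 (Nat.lt_succ_of_le hi) with hi | rfl
    · rw [hcell i (by omega)]
    · rw [hlast]; rfl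
  · intro i hi
    rcases Nat.lt_succ_iff_lt_or_eq.1 (Nat.lt_succ_of_le hi) with hi | rfl
    · rw [hcell i (by omega), decide_eq_false (by omega)]; exact hf i (by omega)
    · rw [hlast]; simp
  · rw [hlast]; rfl
  · intro j hj
    rw [hτ₅, Function.update_of_ne (by omega), hτ₄, Function.update_of_ne (by omega), hr _ (by omega)]

/-- A simulated computation that halts. -/
theorem Running.halt {τ : ℤ → Cell K C} {o : Option K} {b : ℤ} {pos n : ℕ} {w : ℕ → C}
    (h : Running τ b n w) (hpos : pos < n) (hD : D o (pos = 0) (w pos) = none) :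
    ∃ y, AbsStep (rule D) State.dir (.run o, b + pos, τ) y ∧ y.1 = .halted := by
  refine ⟨_, absStep_iff (F := rule D) (dir := State.dir) (s := .run o) (p := b + pos) (τ := τ)
    (s' := .halted) (c := { τ (b + pos) with mark := .final o }) ?_, rfl⟩
  have hk : (decide ((τ (b + pos)).kind = .first)) = decide (pos = 0) := by
    rw [h.kind pos hpos.le]
    by_cases h0 : pos = 0 <;> simp [h0]
  simp only [rule, hk, h.content pos hpos.le, hD, h.mark pos hpos.le]

/-- The launch of a program. -/
theorem Running.start {τ : ℤ → Cell K C} (o : Option K) {b : ℤ} {n : ℕ} {w : ℕ → C}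
    (h : Running τ b n w) (hn : 0 < n) (hb : (τ b).hist = none) :
    ∃ τ', AbsStep (rule D) State.dir (.launch o, b, τ) (.run none, b, τ') ∧ Running τ' b n w ∧
      ∀ j > b, τ' j = τ j := by
  have hk := h.kind 0 (by omega)
  simp only [Nat.cast_zero, add_zero, if_true] at hk
  refine ⟨Function.update τ b { τ b with hist := some (.inl o) }, ?_, ?_, ?_⟩
  · have := absStep_iff (F := rule D) (dir := State.dir) (s := .launch o) (p := b) (τ := τ)
      (s' := .run none) (c := { τ b with hist := some (.inl o) }) (by simp [rule, hk, hb])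
    simpa [State.dir] using this
  · have hu : ∀ i : ℕ, Function.update τ b { τ b with hist := some (.inl o) } (b + i) =
        { τ (b + i) with hist := if i = 0 then some (.inl o) else (τ (b + i)).hist } := by
      intro i
      by_cases hi : i = 0
      · simp [hi]
      · rw [Function.update_of_ne (by omega), if_neg hi]
    refine ⟨fun i hi => ?_, fun i hi => ?_, fun i hi => ?_, fun i hi => ?_, ?_⟩ <;> rw [hu]
    · exact h.content i hi
    · exact h.kind i hi
    · exact h.mark i hi
    · exact h.front i hi
    · rw [if_neg (by omega)]; exact h.hist
  · intro j hj
    rw [Function.update_of_ne (by omega)]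

theorem quit_halts {τ : ℤ → Cell K C} (o : Option K) {b : ℤ} {c : C}
    (h : τ b = ⟨.quit, c, false, .none, none⟩) :
    ∃ y, AbsStep (rule D) State.dir (.launch o, b, τ) y ∧ y.1 = .halted :=
  ⟨_, absStep_iff (F := rule D) (dir := State.dir) (s := .launch o) (p := b) (τ := τ)
    (s' := .halted) (c := { τ b with hist := some (.inl o) }) (by simp [rule, h]), rfl⟩

end HistorySim

/-! ### From partial recursive functions to finite machines -/

namespace Turing.PartrecToTM2

theorem trNat_two_mul {n : ℕ} (hn : n ≠ 0) : trNat (2 * n) = Γ'.bit0 :: trNat n := by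
  have h : ((2 * n : ℕ) : Num) = Num.bit0 (n : Num) := by
    rw [← Num.to_nat_inj, Num.to_of_nat, Num.cast_bit0, Num.to_of_nat, two_mul]
  rw [trNat, trNat, h]
  cases hm : (n : Num) with
  | zero => exact absurd (by rw [← Num.to_of_nat n, hm]; rfl) hn
  | pos p => rfl

theorem trNat_two_mul_add_one (n : ℕ) : trNat (2 * n + 1) = Γ'.bit1 :: trNat n := by
  have h : ((2 * n + 1 : ℕ) : Num) = Num.bit1 (n : Num) := by
    rw [← Num.to_nat_inj, Num.to_of_nat, Num.cast_bit1, Num.to_of_nat, two_mul]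
  rw [trNat, trNat, h]
  cases (n : Num) with
  | zero => rfl
  | pos p => rfl

/-- The binary digits of `n`, the lowest digit first, with the digits replaced by `e₀` and `e₁`. -/
def digitStep (e₀ e₁ : ℕ) (x : ℕ × List ℕ) : ℕ × List ℕ :=
  if x.1 = 0 then x else (x.1 / 2, x.2 ++ [if x.1 % 2 = 0 then e₀ else e₁])

/-- A step at least halves a positive number, so `n` steps suffice, and further steps change
nothing. The digits are thus obtained by a bounded iteration, with `n` itself as the bound. -/
theorem iterate_digitStep (enc : Γ' → ℕ) (n : ℕ) : ∀ (k : ℕ) (_ : n ≤ k) (l : List ℕ),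
    (digitStep (enc .bit0) (enc .bit1))^[k] (n, l) = (0, l ++ (trNat n).map enc) := by
  induction n using Nat.strong_induction_on with
  | _ n ih =>
    intro k hk l
    by_cases h0 : n = 0
    · subst h0
      rw [Function.iterate_fixed (by simp [digitStep])]
      simp
    · obtain ⟨k, rfl⟩ : ∃ k', k = k' + 1 := ⟨k - 1, by omega⟩
      rw [Function.iterate_succ_apply, digitStep]
      simp only [h0, if_false]
      rw [ih _ (by omega) _ (by omega)]
      rcases Nat.even_or_odd' n with ⟨m, rfl | rfl⟩
      · rw [trNat_two_mul (by omega)]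
        simp
      · rw [trNat_two_mul_add_one]
        have : (2 * m + 1) / 2 = m := by omega
        simp [this]

theorem primrec_map_trNat (enc : Γ' → ℕ) : Primrec fun n => (trNat n).map enc := by
  have hstep : Primrec (digitStep (enc .bit0) (enc .bit1)) := by
    refine Primrec.ite (Primrec.eq.comp Primrec.fst (Primrec.const 0)) Primrec.id
      (Primrec.pair (Primrec.nat_div.comp Primrec.fst (Primrec.const 2))
        (Primrec.list_concat.comp Primrec.snd ?_))
    exact Primrec.ite (Primrec.eq.comp (Primrec.nat_mod.comp Primrec.fst (Primrec.const 2))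
      (Primrec.const 0)) (Primrec.const _) (Primrec.const _)
  have h : Primrec fun n : ℕ => (digitStep (enc .bit0) (enc .bit1))^[n] (n, []) :=
    Primrec.nat_iterate Primrec.id (Primrec.pair Primrec.id (Primrec.const []))
      (hstep.comp Primrec.snd).to₂
  exact (Primrec.snd.comp h).of_eq fun n => by rw [iterate_digitStep enc n n le_rfl]; simp

theorem length_trNat_le (n : ℕ) : (trNat n).length ≤ n := by
  induction n using Nat.strong_induction_on with
  | _ n ih =>
    rcases Nat.even_or_odd' n with ⟨m, rfl | rfl⟩
    · rcases Nat.eq_zero_or_pos m with rfl | hm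
      · simp
      · rw [trNat_two_mul hm.ne', List.length_cons]
        have := ih m (by omega)
        omega
    · rw [trNat_two_mul_add_one, List.length_cons]
      have := ih m (by omega)
      omega

theorem lt_two_pow_length_trNat (n : ℕ) : n < 2 ^ (trNat n).length := by
  induction n using Nat.strong_induction_on with
  | _ n ih =>
    rcases Nat.even_or_odd' n with ⟨m, rfl | rfl⟩
    · rcases Nat.eq_zero_or_pos m with rfl | hm
      · simp
      · rw [trNat_two_mul hm.ne', List.length_cons, pow_succ]
        have := ih m (by omega)
        omega
    · rw [trNat_two_mul_add_one, List.length_cons, pow_succ]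
      have := ih m (by omega)
      omega

/-- The symbol of the tape of `TM2to1` with `a` on the main stack. -/
def mainSymbol (bottom : Bool) (a : Γ') : TM2to1.Γ' K' fun _ => Γ' :=
  (bottom, Function.update (fun _ => none) K'.main (some a))

theorem trInit_trList (x : ℕ) : TM2to1.trInit (Γ := fun _ => Γ') K'.main (trList [x]) =
    mainSymbol true .cons :: (trNat x).reverse.map (mainSymbol false) := by
  have h : (trList [x]).reverse = .cons :: (trNat x).reverse := by simp
  rw [TM2to1.trInit, h]
  rfl

instance : Finite K' := Finite.of_equiv _ (proxy_equiv% K')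

end Turing.PartrecToTM2

open Turing Turing.PartrecToTM2 in
/-- Every partial recursive function `g` is computed by a finite `TM0` machine whose input is
written by a primitive recursive function. The final tape carries a nonblank symbol so far to the
right that its distance bounds the binary length of the value. -/
theorem Turing.exists_TM0_of_partrec {g : ℕ →. ℕ} (hg : Nat.Partrec g) :
    ∃ (Γ Λ : Type) (_ : Inhabited Γ) (_ : Inhabited Λ) (_ : Finite Γ) (M : TM0.Machine Γ Λ)
      (S : Set Λ) (prog : ℕ → List Γ), S.Finite ∧ TM0.Supports M S ∧
      (∀ enc : Γ → ℕ, Primrec fun x => (prog x).map enc) ∧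
      (∀ x, 0 < (prog x).length ∧ (prog x).length ≤ x + 1) ∧
      ∀ x, ((g x).Dom → (StateTransition.eval (TM0.step M) (TM0.init (prog x))).Dom) ∧
        ∀ c ∈ StateTransition.eval (TM0.step M) (TM0.init (prog x)),
          ∃ y ∈ g x, ∃ i : ℕ, y < 2 ^ i ∧ c.Tape.nth i ≠ default := by
  obtain ⟨c, hc⟩ := ToPartrec.Code.exists_code (n := 1) (f := fun v => g v.head)
    (Nat.Partrec'.part_iff₁.2 (Partrec.nat_iff.2 hg))
  replace hc : ∀ x, c.eval [x] = (g x).map fun y => [y] := fun x => hc ⟨[x], rfl⟩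
  let _ : Inhabited PartrecToTM2.Λ' := ⟨trNormal c Cont'.halt⟩
  let _ : Fintype K' := Fintype.ofFinite K'
  let M₁ := TM2to1.tr PartrecToTM2.tr
  let M₀ := TM1to0.tr M₁
  have hsupp : TM0.Supports M₀ _ := TM1to0.tr_supports M₁
    (TM2to1.tr_supports PartrecToTM2.tr (PartrecToTM2.tr_supports c Cont'.halt))
  refine ⟨_, _, inferInstance, inferInstance, Finite.of_fintype (TM2to1.Γ' K' fun _ => Γ'), M₀, _,
    fun x => TM2to1.trInit K'.main (trList [x]),
    Finset.finite_toSet _, hsupp, ?_, ?_, ?_⟩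
  · intro enc
    refine (Primrec.list_cons.comp (Primrec.const (enc (mainSymbol true .cons)))
      (Primrec.list_reverse.comp (primrec_map_trNat (enc ∘ mainSymbol false)))).of_eq fun x => ?_
    simp only [trInit_trList]
    simp
  · intro x
    have := length_trNat_le x
    simp only [trInit_trList]
    simpa
  · intro x
    have hinit : PartrecToTM2.init c [x] = TM2.init K'.main (trList [x]) := by
      have : K'.elim (trList [x]) [] [] [] = Function.update (fun _ => []) K'.main (trList [x]) := by
        funext k; cases k <;> rfl
      exact congrArg (TM2.Cfg.mk (some (trNormal c Cont'.halt)) none) this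
    have h₂ := PartrecToTM2.tr_eval c [x]
    rw [hinit, hc] at h₂
    have h₁ := TM2to1.trCfg_init (Λ := PartrecToTM2.Λ') (σ := Option PartrecToTM2.Γ')
      (Γ := fun _ => Γ') K'.main (trList [x])
    have r₁ := TM2to1.tr_respects PartrecToTM2.tr
    have r₀ := TM1to0.tr_respects M₁
    refine ⟨fun hx => ?_, fun d hd => ?_⟩
    · refine (StateTransition.tr_eval_dom r₀ rfl).2 ((StateTransition.tr_eval_dom r₁ h₁).2 ?_)
      rw [h₂]
      exact hx
    · obtain ⟨d₁, e₁, hd₁⟩ := StateTransition.tr_eval_rev r₀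
        (a₁ := TM1.init (TM2to1.trInit K'.main (trList [x]))) rfl hd
      obtain ⟨d₂, e₂, hd₂⟩ := StateTransition.tr_eval_rev r₁ h₁ hd₁
      rw [h₂] at hd₂
      obtain ⟨v, hv, rfl⟩ := (Part.mem_map_iff _).1 hd₂
      obtain ⟨y, hy, rfl⟩ := (Part.mem_map_iff _).1 hv
      -- `trList [y]` has one symbol more than `trNat y`, the separator, so the main stack occupies
      -- the cell at this distance from its bottom, where the head ends.
      refine ⟨y, hy, (trNat y).length, lt_two_pow_length_trNat y, ?_⟩
      subst e₁
      cases e₂ with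
      | mk L hL =>
        intro h0
        have h3 := TM2to1.stk_nth_val (trNat y).length (hL K'.main)
        have h4 := TM2to1.addBottom_nth_snd L (trNat y).length
        have h5 : (Tape.mk' ∅ (TM2to1.addBottom L)).nth ((trNat y).length : ℕ) = default := h0
        rw [Tape.mk'_nth_nat] at h5
        rw [h5] at h4
        rw [← h4] at h3
        have h6 : (trList [y]).reverse[(trNat y).length]? = none := h3.symm
        simp at h6

/-! ### Counted runs and the folding of a two-sided tape -/

/-- The configuration after `n` steps of a partial transition function. -/
def runFor {σ : Type} (f : σ → Option σ) (a : σ) : ℕ → Option σ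
  | 0 => some a
  | n + 1 => (runFor f a n).bind f

theorem reaches_of_runFor {σ : Type} {f : σ → Option σ} {a b : σ} {n : ℕ}
    (h : runFor f a n = some b) : StateTransition.Reaches f a b := by
  induction n generalizing b with
  | zero => cases h; exact ReflTransGen.refl
  | succ n ih =>
    obtain ⟨c, hc, hb⟩ := Option.bind_eq_some_iff.1 h
    exact (ih hc).tail hb

theorem exists_runFor_of_reaches {σ : Type} {f : σ → Option σ} {a b : σ}
    (h : StateTransition.Reaches f a b) : ∃ n, runFor f a n = some b := by
  induction h with
  | refl => exact ⟨0, rfl⟩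
  | tail _ hb ih =>
    obtain ⟨n, hn⟩ := ih
    exact ⟨n + 1, by rw [runFor, hn]; exact hb⟩

/-- The simulation is in lockstep, so running times carry over exactly; the comparison of a running
time with the value computed depends on this. -/
theorem runFor_of_simulation {σ ρ : Type} {f : σ → Option σ} {g : ρ → Option ρ} {R : σ → ρ → Prop}
    (hsome : ∀ a b a', R a b → f a = some a' → ∃ b', g b = some b' ∧ R a' b')
    (hnone : ∀ a b, R a b → f a = none → g b = none) {a : σ} {b : ρ} (hab : R a b) (n : ℕ) :
    (runFor f a n = none ∧ runFor g b n = none) ∨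
      ∃ a' b', runFor f a n = some a' ∧ runFor g b n = some b' ∧ R a' b' := by
  induction n with
  | zero => exact .inr ⟨a, b, rfl, rfl, hab⟩
  | succ n ih =>
    simp only [runFor]
    obtain ⟨h1, h2⟩ | ⟨a', b', h1, h2, h⟩ := ih
    · simp [h1, h2]
    · rw [h1, h2, Option.bind_some, Option.bind_some]
      cases hf : f a' with
      | none => exact .inl ⟨rfl, hnone _ _ h hf⟩
      | some a'' =>
        obtain ⟨b'', hb, h'⟩ := hsome _ _ _ h hf
        exact .inr ⟨a'', b'', rfl, hb, h'⟩

/-- One step of a machine with a one-sided tape, whose rule sees whether the head is at the end of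
the tape. The state `none` is the initial one. -/
def oneSidedStep {K C : Type} (D : Option K → Bool → C → Option (K × C × SignType))
    (x : Option K × ℕ × (ℕ → C)) : Option (Option K × ℕ × (ℕ → C)) :=
  (D x.1 (x.2.1 = 0) (x.2.2 x.2.1)).map fun y =>
    (some y.1, ((x.2.1 : ℤ) + y.2.2).toNat, Function.update x.2.2 x.2.1 y.2.1)

namespace Turing

theorem Tape.nth_mk₁ {Γ : Type} [Inhabited Γ] (l : List Γ) (i : ℤ) :
    (Tape.mk₁ l).nth i = if 0 ≤ i then l.getD i.toNat default else default := by
  rw [Tape.mk₁, Tape.mk₂]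
  obtain n | n := i
  · simp [← List.getD_default_eq_getI,
      Tape.mk'_nth_nat (ListBlank.mk []) (ListBlank.mk l) n]
  · have : (Tape.mk' (ListBlank.mk ([] : List Γ)) (ListBlank.mk l)).nth (Int.negSucc n) = default := by
      change ListBlank.nth (Tape.mk' (ListBlank.mk ([] : List Γ)) (ListBlank.mk l)).left n = _
      rw [Tape.mk'_left, ListBlank.nth_mk]
      simp
    rw [this, if_neg (by omega)]

variable {Γ Λ Q : Type}

/-- The tape of a `TM0` machine folded at the origin: the second component of a state says that the
head is on the left half. -/
def foldRule [Inhabited Λ] (M : TM0.Machine Γ Λ) (r : Λ → Q) (i : Q → Λ) (o : Option (Q × Bool))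
    (boundary : Bool) (c : Γ × Γ) : Option ((Q × Bool) × (Γ × Γ) × SignType) :=
  let k := o.getD (r default, false)
  (M (i k.1) (if k.2 then c.2 else c.1)).map fun y =>
    match y.2 with
    | .write a => ((r y.1, k.2), if k.2 then (c.1, a) else (a, c.2), 0)
    | .move d =>
      if (d = .right) ↔ k.2 = false then ((r y.1, k.2), c, 1)
      else if boundary then ((r y.1, !k.2), c, 0)
      else ((r y.1, k.2), c, -1)

theorem foldRule_boundary [Inhabited Λ] (M : TM0.Machine Γ Λ) (r : Λ → Q) (i : Q → Λ)
    (o : Option (Q × Bool)) (c : Γ × Γ) (k : Q × Bool) (c' : Γ × Γ) (e : SignType)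
    (h : foldRule M r i o true c = some (k, c', e)) : e ≠ -1 := by
  obtain ⟨⟨q, s⟩, -, hy⟩ := Option.map_eq_some_iff.1 h
  cases s with
  | write a =>
    simp only [Prod.mk.injEq] at hy
    rw [← hy.2.2]; decide
  | move d =>
    simp only at hy
    split_ifs at hy <;> simp only [Prod.mk.injEq] at hy <;> rw [← hy.2.2] <;> decide

/-- The relation between a two-sided and a folded tape. -/
def FoldRel [Inhabited Γ] [Inhabited Λ] (S : Set Λ) (r : Λ → Q) (c : TM0.Cfg Γ Λ)
    (x : Option (Q × Bool) × ℕ × (ℕ → Γ × Γ)) : Prop :=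
  ∃ (A : ℤ → Γ) (s : Bool), c.q ∈ S ∧ x.1.getD (r default, false) = (r c.q, s) ∧
    (∀ i, c.Tape.nth i = A ((if s then -1 - (x.2.1 : ℤ) else x.2.1) + i)) ∧
    ∀ i : ℕ, x.2.2 i = (A i, A (-1 - i))

theorem FoldRel.step_none [Inhabited Γ] [Inhabited Λ] {M : TM0.Machine Γ Λ} {S : Set Λ} {r : Λ → Q}
    {i : Q → Λ} (hi : ∀ q ∈ S, i (r q) = q) {c : TM0.Cfg Γ Λ}
    {x : Option (Q × Bool) × ℕ × (ℕ → Γ × Γ)} (h : FoldRel S r c x) (hc : TM0.step M c = none) :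
    oneSidedStep (foldRule M r i) x = none := by
  obtain ⟨A, s, hS, hst, hT, hw⟩ := h
  obtain ⟨q, T⟩ := c
  have h0 := hT 0
  simp only [Tape.nth_zero, add_zero] at h0
  simp only [TM0.step, Option.map_eq_none_iff] at hc
  simp only [oneSidedStep, foldRule, hst, hi _ hS, Option.map_eq_none_iff, hw]
  cases s <;> simp_all

theorem FoldRel.step_some [Inhabited Γ] [Inhabited Λ] {M : TM0.Machine Γ Λ} {S : Set Λ}
    (hM : TM0.Supports M S) {r : Λ → Q}
    {i : Q → Λ} (hi : ∀ q ∈ S, i (r q) = q) {c : TM0.Cfg Γ Λ}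
    {x : Option (Q × Bool) × ℕ × (ℕ → Γ × Γ)} (h : FoldRel S r c x) {c' : TM0.Cfg Γ Λ}
    (hc : TM0.step M c = some c') :
    ∃ x', oneSidedStep (foldRule M r i) x = some x' ∧ FoldRel S r c' x' := by
  have hS' : c'.q ∈ S := TM0.step_supports M hM hc h.choose_spec.choose_spec.1
  obtain ⟨A, s, hS, hst, hT, hw⟩ := h
  obtain ⟨q, T⟩ := c
  obtain ⟨o, p, w⟩ := x
  have h0 := hT 0
  simp only [Tape.nth_zero, add_zero] at h0
  simp only [TM0.step, Option.map_eq_some_iff] at hc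
  obtain ⟨⟨q', st⟩, hq, rfl⟩ := hc
  simp only at hw hT hst hS hS' h0
  have hread : (if s = true then (w p).2 else (w p).1) = T.head := by
    rw [h0, hw]; cases s <;> rfl
  simp only [oneSidedStep, foldRule, hst, hi _ hS, hread, hq, Option.map_some, Option.some.injEq,
    exists_eq_left']
  cases st with
  | write a =>
    refine ⟨Function.update A (if s then -1 - (p : ℤ) else p) a, s, hS', rfl, ?_, ?_⟩
    · intro j
      simp only [Tape.write_nth, Function.update_apply, hT]
      cases s <;> simp
    · intro j
      by_cases hj : j = p
      · subst hj
        cases s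
        · simp [Function.update_apply, hw]; omega
        · simp [Function.update_apply, hw]; omega
      · cases s
        · simp [Function.update_apply, hj, hw]; omega
        · simp [Function.update_apply, hj, hw]; omega
  | move d =>
    have hup : ∀ j, Function.update w p (w p) j = (A j, A (-1 - j)) := by
      intro j; rw [Function.update_eq_self, hw]
    cases d <;> cases s
    -- From cell `0` the move to the left leads to cell `-1`, which is position `0` of the other
    -- track: the track changes and the head stays.
    · by_cases hp : p = 0
      · refine ⟨A, true, hS', by simp [hp], ?_, by simpa [hp] using hup⟩
        intro j
        simp [hp, Tape.move_left_nth, hT, sub_eq_add_neg, add_comm]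
      · refine ⟨A, false, hS', by simp [hp], ?_, by simpa [hp] using hup⟩
        intro j
        simp [hp, Tape.move_left_nth, hT]
        congr 1; omega
    · refine ⟨A, true, hS', by simp, ?_, by simpa using hup⟩
      intro j
      simp [Tape.move_left_nth, hT]
      congr 1; omega
    · refine ⟨A, false, hS', by simp, ?_, by simpa using hup⟩
      intro j
      simp [Tape.move_right_nth, hT]
      congr 1; omega
    · by_cases hp : p = 0
      · refine ⟨A, false, hS', by simp [hp], ?_, by simpa [hp] using hup⟩
        intro j
        simp [hp, Tape.move_right_nth, hT]
      · refine ⟨A, true, hS', by simp [hp], ?_, by simpa [hp] using hup⟩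
        intro j
        simp [hp, Tape.move_right_nth, hT]
        congr 1; omega

/-- Positions are counted from the head. A step writes at `0` or shifts by one, so the right end of
the nonblank part advances by at most one per step. A long output therefore forces a long run. -/
theorem TM0.lt_of_nth_ne_default [Inhabited Γ] [Inhabited Λ] {M : TM0.Machine Γ Λ} (l : List Γ)
    {n : ℕ} {c : TM0.Cfg Γ Λ} (h : runFor (TM0.step M) (TM0.init l) n = some c) {i : ℤ}
    (hi : c.Tape.nth i ≠ default) : i < l.length + n := by
  induction n generalizing c i with
  | zero =>
    cases h
    by_contra hlt
    refine hi ?_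
    rw [TM0.init, Tape.nth_mk₁, if_pos (by omega), List.getD_eq_default]
    omega
  | succ n ih =>
    obtain ⟨⟨q, T⟩, hd, hc⟩ := Option.bind_eq_some_iff.1 h
    obtain ⟨⟨q', s⟩, -, rfl⟩ := Option.map_eq_some_iff.1 hc
    cases s with
    | write a =>
      rw [Tape.write_nth] at hi
      split_ifs at hi with h0
      · omega
      · have := ih hd hi; push_cast; omega
    | move d =>
      cases d
      · simp only [Tape.move_left_nth] at hi
        have := ih hd hi; push_cast; omega
      · simp only [Tape.move_right_nth] at hi
        have := ih hd hi; push_cast; omega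

end Turing

open Turing in
/-- Every partial recursive function `g` is computed by a finite machine with a one-sided tape whose
input is written by a primitive recursive function, and the time of a halting computation bounds
the binary length of the value. -/
theorem exists_oneSided_of_partrec {g : ℕ →. ℕ} (hg : Nat.Partrec g) :
    ∃ (K C : Type) (_ : Finite K) (_ : Finite C) (c₀ : C)
      (D : Option K → Bool → C → Option (K × C × SignType)) (prog : ℕ → List C),
      (∀ o c k c' e, D o true c = some (k, c', e) → e ≠ -1) ∧
      (∀ enc : C → ℕ, Primrec fun x => (prog x).map enc) ∧
      (∀ x, 1 < (prog x).length ∧ (prog x).length ≤ x + 2) ∧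
      ∀ x, ((g x).Dom →
          ∃ n, runFor (oneSidedStep D) (none, 0, fun i => (prog x).getD i c₀) n = none) ∧
        ∀ n z, runFor (oneSidedStep D) (none, 0, fun i => (prog x).getD i c₀) n = some z →
          oneSidedStep D z = none → ∃ y ∈ g x, y < 2 ^ (n + (prog x).length) := by
  classical
  obtain ⟨Γ, Λ, _, _, _, M, S, prog, hfin, hS, hprim, hlen, hM⟩ := exists_TM0_of_partrec hg
  -- Only the labels in the finite supporting set `S` are kept as states; the label type itself may
  -- be infinite.
  let r : Λ → S := fun q => if h : q ∈ S then ⟨q, h⟩ else ⟨default, hS.1⟩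
  have hr : ∀ q ∈ S, ((r q : S) : Λ) = q := fun q hq => by simp [r, hq]
  have : Finite S := hfin
  let D := foldRule M r Subtype.val
  -- The appended blank gives every program at least two cells. After `m` steps the front is at
  -- `(prog x).length + m`, so the next head position, at most `m + 1`, is still strictly to its
  -- left.
  refine ⟨S × Bool, Γ × Γ, inferInstance, inferInstance, (default, default), D,
    fun x => (prog x ++ [default]).map fun a => (a, default), foldRule_boundary M r _, ?_,
    by simpa using hlen, ?_⟩
  · intro enc
    have := Primrec.list_append.comp (hprim fun a => enc (a, default))
      (Primrec.const [enc (default, default)])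
    simpa [Function.comp_def] using this
  intro x
  set w : ℕ → Γ × Γ := fun i => ((prog x ++ [default]).map fun a => (a, default)).getD i
    (default, default)
    with hw
  have hsim := runFor_of_simulation (f := TM0.step M) (g := oneSidedStep D)
    (R := FoldRel S r) (fun a b a' h h' => h.step_some hS hr h') (fun a b h h' => h.step_none hr h')
    (a := TM0.init (prog x)) (b := (none, 0, w)) (by
      refine ⟨(Tape.mk₁ (prog x)).nth, false, hS.1, rfl, fun i => by simp [TM0.init], fun i => ?_⟩
      rw [Tape.nth_mk₁, Tape.nth_mk₁, if_pos (by omega), if_neg (by omega)]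
      simp only [hw, Int.toNat_natCast]
      rw [List.getD_map (f := fun a => (a, default)) (d := default)]
      rcases lt_trichotomy i (prog x).length with h | h | h
      · rw [List.getD_append _ _ _ _ h]
      · subst h; simp
      · rw [List.getD_eq_default _ _ (by simp; omega), List.getD_eq_default _ _ h.le])
  refine ⟨fun hx => ?_, fun n z hz hz' => ?_⟩
  · obtain ⟨c, hc⟩ := Part.dom_iff_mem.1 ((hM x).1 hx)
    obtain ⟨hr, hn⟩ := StateTransition.mem_eval.1 hc
    obtain ⟨n, hrun⟩ := exists_runFor_of_reaches hr
    obtain ⟨-, h⟩ | ⟨a, b, h, h', -⟩ := hsim (n + 1)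
    · exact ⟨n + 1, h⟩
    · rw [runFor, hrun, Option.bind_some, hn] at h
      cases h
  · obtain ⟨-, h⟩ | ⟨c, b, h, h', hR⟩ := hsim n
    · rw [hz] at h; cases h
    rw [hz] at h'
    cases h'
    have hc : TM0.step M c = none := by
      cases hs : TM0.step M c with
      | none => rfl
      | some c' =>
        obtain ⟨_, h1, -⟩ := hR.step_some hS hr hs
        rw [h1] at hz'; cases hz'
    obtain ⟨y, hy, i, hyi, hi⟩ := (hM x).2 c (StateTransition.mem_eval.2 ⟨reaches_of_runFor h, hc⟩)
    refine ⟨y, hy, hyi.trans_le (Nat.pow_le_pow_right (by omega) ?_)⟩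
    have := TM0.lt_of_nth_ne_default _ h hi
    rw [List.length_map, List.length_append]
    omega

/-! ### Inputs made of blocks -/

namespace HistorySim

variable {K C : Type}

/-- The cells of a program: its first cell is marked, and the front stands behind it. -/
def progCells (c₀ : C) : List C → List (Cell K C)
  | [] => []
  | a :: l => ⟨.first, a, false, .none, none⟩ :: (l.map plainCell ++
      [⟨.plain, c₀, true, .none, none⟩])

/-- The cell that orders to halt. -/
def quitCell (c₀ : C) : Cell K C := ⟨.quit, c₀, false, .none, none⟩

/-- The blocks of the input: a blank cell, an order to halt, or a program. -/
def block (c₀ : C) (prog : ℕ → List C) : Option (Option ℕ) → List (Cell K C)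
  | none => [plainCell c₀]
  | some none => [quitCell c₀]
  | some (some x) => progCells c₀ (prog x)

/-- The position of the block number `j`. -/
def offset (c₀ : C) (prog : ℕ → List C) (B : ℕ → Option (Option ℕ)) (j : ℕ) : ℕ :=
  ((List.range j).flatMap fun i => block (K := K) c₀ prog (B i)).length

/-- The input that consists of the given blocks. -/
def input (c₀ : C) (prog : ℕ → List C) (B : ℕ → Option (Option ℕ)) (i : ℤ) : Cell K C :=
  if 0 ≤ i then
    ((List.range (i.toNat + 1)).flatMap fun j => block c₀ prog (B j)).getD i.toNat (plainCell c₀)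
  else plainCell c₀

theorem length_progCells (c₀ : C) {l : List C} (h : 0 < l.length) :
    (progCells (K := K) c₀ l).length = l.length + 1 := by
  cases l with
  | nil => simp at h
  | cons a l => simp [progCells]

theorem length_block_pos (c₀ : C) {prog : ℕ → List C} (hprog : ∀ x, 1 < (prog x).length)
    (b : Option (Option ℕ)) : 0 < (block (K := K) c₀ prog b).length := by
  rcases b with _ | _ | x
  · simp [block]
  · simp [block]
  · simp [block, length_progCells c₀ (zero_lt_one.trans (hprog x))]

section

variable {c₀ : C} {prog : ℕ → List C} {B : ℕ → Option (Option ℕ)}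

theorem offset_zero : offset (K := K) c₀ prog B 0 = 0 := rfl

theorem offset_succ (j : ℕ) : offset (K := K) c₀ prog B (j + 1) =
    offset (K := K) c₀ prog B j + (block (K := K) c₀ prog (B j)).length := by
  simp [offset, List.range_succ]

/-- Blocks are nonempty, so the cell `i` of the input depends on the blocks `0, …, i` alone. This is
what makes the input computable cell by cell. -/
theorem le_offset (hprog : ∀ x, 1 < (prog x).length) (j : ℕ) :
    j ≤ offset (K := K) c₀ prog B j := by
  induction j with
  | zero => exact Nat.zero_le _
  | succ j ih =>
    have := length_block_pos (K := K) c₀ hprog (B j)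
    rw [offset_succ]
    omega

/-- A blank block is a single cell, so the front, advancing one cell per simulated step, passes
exactly one block per step. -/
theorem offset_add_of_none {j m : ℕ} (h : ∀ i, j ≤ i → i < j + m → B i = none) :
    offset (K := K) c₀ prog B (j + m) = offset (K := K) c₀ prog B j + m := by
  induction m with
  | zero => rfl
  | succ m ih =>
    rw [← add_assoc, offset_succ, ih fun i h1 h2 => h i h1 (by omega), h (j + m) (by omega) (by omega)]
    simp [block, add_assoc]

theorem input_offset_add (hprog : ∀ x, 1 < (prog x).length) (j k : ℕ)
    (hk : k < (block (K := K) c₀ prog (B j)).length) :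
    input (K := K) c₀ prog B (offset (K := K) c₀ prog B j + k) =
      (block c₀ prog (B j)).getD k (plainCell c₀) := by
  have hle : j ≤ offset (K := K) c₀ prog B j := le_offset hprog j
  rw [input, if_pos (by positivity)]
  have e : ((offset (K := K) c₀ prog B j : ℤ) + k).toNat = offset (K := K) c₀ prog B j + k := by omega
  rw [e]
  obtain ⟨d, hd⟩ := Nat.exists_eq_add_of_le (show j + 1 ≤ offset (K := K) c₀ prog B j + k + 1 by omega)
  rw [hd, List.range_add, List.flatMap_append, List.range_succ, List.flatMap_append]
  have hlen : ((List.range j).flatMap fun i => block (K := K) c₀ prog (B i)).length =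
    offset (K := K) c₀ prog B j := rfl
  simp only [List.flatMap_singleton]
  rw [List.getD_append _ _ _ _ (by rw [List.length_append, hlen]; omega),
    List.getD_append_right _ _ _ _ (by rw [hlen]; omega), hlen, Nat.add_sub_cancel_left]

theorem input_of_none (hprog : ∀ x, 1 < (prog x).length) {j : ℕ} (h : B j = none) :
    input (K := K) c₀ prog B (offset (K := K) c₀ prog B j) = plainCell c₀ := by
  have := input_offset_add (K := K) (c₀ := c₀) (B := B) hprog j 0 (length_block_pos c₀ hprog _)
  rw [h] at this
  simpa [block] using this

theorem input_of_quit (hprog : ∀ x, 1 < (prog x).length) {j : ℕ} (h : B j = some none) :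
    input (K := K) c₀ prog B (offset (K := K) c₀ prog B j) = quitCell c₀ := by
  have := input_offset_add (K := K) (c₀ := c₀) (B := B) hprog j 0 (length_block_pos c₀ hprog _)
  rw [h] at this
  simpa [block] using this

theorem running_input (hprog : ∀ x, 1 < (prog x).length) {j x : ℕ} (h : B j = some (some x))
    {τ : ℤ → Cell K C} (hτ : ∀ i ≥ (offset (K := K) c₀ prog B j : ℤ), τ i = input c₀ prog B i) :
    Running τ (offset (K := K) c₀ prog B j) (prog x).length (fun i => (prog x).getD i c₀) ∧
      (τ (offset (K := K) c₀ prog B j)).hist = none := by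
  have hcell : ∀ i ≤ (prog x).length, τ (offset (K := K) c₀ prog B j + i) =
      ⟨if i = 0 then .first else .plain, (prog x).getD i c₀, decide (i = (prog x).length), .none,
        none⟩ := by
    intro i hi
    have hl := length_progCells (K := K) c₀ (zero_lt_one.trans (hprog x))
    have := input_offset_add (K := K) (c₀ := c₀) (B := B) hprog j i (by
      rw [h, block, hl]; omega)
    rw [hτ _ (by omega), this, h, block]
    have hx := hprog x
    cases hp : prog x with
    | nil => simp [hp] at hx
    | cons a l =>
      rw [hp] at hi
      simp only [List.length_cons] at hi
      cases i with
      | zero => simp [progCells]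
      | succ i =>
        rcases Nat.lt_or_eq_of_le (Nat.le_of_succ_le_succ hi) with hi | rfl
        · simp [progCells, plainCell, List.getElem?_append, hi, hi.ne]
        · simp [progCells]
  refine ⟨⟨?_, ?_, ?_, ?_, ?_⟩, ?_⟩
  · intro i hi; rw [hcell i hi]
  · intro i hi; rw [hcell i hi]
  · intro i hi; rw [hcell i hi]
  · intro i hi; rw [hcell i hi]
  · rw [hcell _ le_rfl]
  · have := hcell 0 (Nat.zero_le _)
    rw [Nat.cast_zero, add_zero] at this
    rw [this]

end

/-- The run of the one-sided machine on the program number `x`. -/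
def progRun (D : Option K → Bool → C → Option (K × C × SignType)) (c₀ : C) (prog : ℕ → List C)
    (x : ℕ) : ℕ → Option (Option K × ℕ × (ℕ → C)) :=
  runFor (oneSidedStep D) (none, 0, fun i => (prog x).getD i c₀)

/-- The head is at the beginning of the nonblank block `j`. -/
def AtBlock (c₀ : C) (prog : ℕ → List C) (B : ℕ → Option (Option ℕ)) (j : ℕ)
    (y : State K C × ℤ × (ℤ → Cell K C)) : Prop :=
  B j ≠ none ∧ ∃ (o : Option K) (τ : ℤ → Cell K C), y = (State.launch o, (offset (K := K) c₀ prog B j : ℤ), τ) ∧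
    ∀ i ≥ (offset (K := K) c₀ prog B j : ℤ), τ i = input c₀ prog B i

/-- The program `x` in the block `j` has been run for `m` steps, and the `m` blocks that follow are
blank. -/
def InRun (D : Option K → Bool → C → Option (K × C × SignType)) (c₀ : C) (prog : ℕ → List C)
    (B : ℕ → Option (Option ℕ)) (j x m : ℕ) (y : State K C × ℤ × (ℤ → Cell K C)) : Prop :=
  B j = some (some x) ∧ (∀ i, j < i → i ≤ j + m → B i = none) ∧
    ∃ (o : Option K) (pos : ℕ) (w : ℕ → C) (τ : ℤ → Cell K C), progRun D c₀ prog x m = some (o, pos, w) ∧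
      y = (State.run o, (offset (K := K) c₀ prog B j : ℤ) + pos, τ) ∧
      Running τ (offset (K := K) c₀ prog B j) ((prog x).length + m) w ∧ pos ≤ m ∧
      (∀ i > m, w i = (prog x).getD i c₀) ∧
      ∀ i > (offset (K := K) c₀ prog B j : ℤ) + ((prog x).length + m : ℕ), τ i = input c₀ prog B i

section

variable {D : Option K → Bool → C → Option (K × C × SignType)} {c₀ : C} {prog : ℕ → List C}
  {B : ℕ → Option (Option ℕ)} {j x m : ℕ} {y : State K C × ℤ × (ℤ → Cell K C)}

theorem AtBlock.quit (hprog : ∀ x, 1 < (prog x).length) (h : AtBlock c₀ prog B j y)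
    (hB : B j = some none) : ∃ z, AbsStep (rule D) State.dir y z ∧ z.1 = .halted := by
  obtain ⟨-, o, τ, rfl, hτ⟩ := h
  exact quit_halts o (by rw [hτ _ le_rfl, input_of_quit hprog hB]; rfl)

theorem AtBlock.run (hprog : ∀ x, 1 < (prog x).length) (h : AtBlock c₀ prog B j y)
    (hB : B j = some (some x)) :
    ∃ z, AbsStep (rule D) State.dir y z ∧ InRun D c₀ prog B j x 0 z := by
  obtain ⟨-, o, τ, rfl, hτ⟩ := h
  obtain ⟨hrun, hhist⟩ := running_input hprog hB hτ
  obtain ⟨τ', hs, hrun', hτ'⟩ := hrun.start (D := D) o (zero_lt_one.trans (hprog x)) hhist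
  refine ⟨_, hs, hB, fun i h1 h2 => by omega, none, 0, _, τ', rfl, by simp, hrun', le_rfl,
    fun _ _ => rfl, fun i hi => ?_⟩
  rw [hτ' _ (by omega), hτ _ (by omega)]

theorem InRun.halt (hprog : ∀ x, 1 < (prog x).length) (h : InRun D c₀ prog B j x m y)
    (hm : progRun D c₀ prog x (m + 1) = none) :
    ∃ z, AbsStep (rule D) State.dir y z ∧ z.1 = .halted := by
  obtain ⟨hB, hbl, o, pos, w, τ, hrun, rfl, hR, hpos, -, -⟩ := h
  have := hprog x
  refine hR.halt (by omega) ?_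
  rw [progRun, runFor, ← progRun, hrun, Option.bind_some, oneSidedStep, Option.map_eq_none_iff] at hm
  exact hm

theorem InRun.step (hD : ∀ o c k c' e, D o true c = some (k, c', e) → e ≠ -1)
    (hprog : ∀ x, 1 < (prog x).length) (h : InRun D c₀ prog B j x m y)
    (hm : progRun D c₀ prog x (m + 1) ≠ none) :
    ∃ z, TransGen (AbsStep (rule D) State.dir) y z ∧
      ((B (j + m + 1) = none ∧ InRun D c₀ prog B j x (m + 1) z) ∨ AtBlock c₀ prog B (j + m + 1) z) := by
  obtain ⟨hB, hbl, o, pos, w, τ, hrun, rfl, hR, hpos, hw, hτ⟩ := h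
  have hx := hprog x
  have hrun' : progRun D c₀ prog x (m + 1) = oneSidedStep D (o, pos, w) := by
    rw [progRun, runFor, ← progRun, hrun, Option.bind_some]
  rw [hrun'] at hm
  obtain ⟨x', hx'⟩ := Option.ne_none_iff_exists'.1 hm
  obtain ⟨⟨k, c, e⟩, hDk, rfl⟩ := Option.map_eq_some_iff.1 hx'
  simp only at hDk hx'
  -- At the end of the tape `hD` forbids a move to the left, so the truncation `toNat` in
  -- `oneSidedStep` has no effect.
  have he : 0 ≤ (pos : ℤ) + e := by
    rcases Nat.eq_zero_or_pos pos with rfl | h0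
    · have := hD o _ k c e (by simpa using hDk)
      cases e <;> simp_all
    · cases e <;> simp <;> omega
  have he1 : (e : ℤ) ≤ 1 := by cases e <;> simp
  obtain ⟨pos', hpos'⟩ := Int.eq_ofNat_of_zero_le he
  -- The program, one cell for its front and `m` blank blocks: the cell behind the present front is
  -- where block `j + m + 1` begins.
  have hoff : offset (K := K) c₀ prog B (j + m + 1) =
      offset (K := K) c₀ prog B j + (prog x).length + m + 1 := by
    have h1 := offset_add_of_none (K := K) (c₀ := c₀) (prog := prog) (B := B) (j := j + 1) (m := m)
      fun i h1 h2 => hbl i (by omega) (by omega)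
    have h2 := offset_succ (K := K) (c₀ := c₀) (prog := prog) (B := B) j
    rw [hB, block, length_progCells c₀ (zero_lt_one.trans hx)] at h2
    rw [show j + m + 1 = j + 1 + m by ring, h1, h2]
    ring
  by_cases hnext : B (j + m + 1) = none
  · have hcell : τ (offset (K := K) c₀ prog B j + ((prog x).length + m : ℕ) + 1) =
        plainCell (w ((prog x).length + m + 1)) := by
      rw [hτ _ (by omega), hw _ (by omega), List.getD_eq_default _ _ (by omega),
        ← input_of_none hprog hnext, hoff]
      congr 1
      push_cast
      ring
    obtain ⟨τ', hs, hR', hτ'⟩ := hR.step (by omega) hDk hpos'.symm (by omega) hcell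
    refine ⟨_, hs, .inl ⟨hnext, hB, fun i h1 h2 => ?_, some k, pos',
      Function.update w pos c, τ', ?_, rfl, ?_, by omega,
      fun i hi => ?_, fun i hi => ?_⟩⟩
    · rcases Nat.lt_or_eq_of_le h2 with h2 | rfl
      · exact hbl i h1 (by omega)
      · exact hnext
    · rw [hrun', hx', hpos', Int.toNat_natCast]
    · rwa [← add_assoc]
    · rw [Function.update_of_ne (by omega), hw i (by omega)]
    · rw [hτ' _ (by omega), hτ _ (by omega)]
  · obtain ⟨τ', hs, -, -, -, -, hτ'⟩ := hR.launch (by omega) hDk hpos'.symm (by omega)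
    refine ⟨_, hs, .inr ⟨hnext, some k, τ', ?_, fun i hi => ?_⟩⟩
    · rw [hoff]
      push_cast
      simp only [add_assoc]
    · rw [hτ' _ (by omega), hτ _ (by omega)]

theorem atBlock_zero (h : B 0 ≠ none) :
    AtBlock c₀ prog B 0 (.launch none, 0, input (K := K) c₀ prog B) :=
  ⟨h, none, _, by simp [offset_zero], fun _ _ => rfl⟩

/-- If no block orders to halt and no program halts before the next block is reached, then the
simulation never ends. -/
theorem exists_invariant (hD : ∀ o c k c' e, D o true c = some (k, c', e) → e ≠ -1)
    (hprog : ∀ x, 1 < (prog x).length) (h0 : B 0 ≠ none) (hquit : ∀ j, B j ≠ some none)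
    (hrun : ∀ j x m, B j = some (some x) → (∀ i, j < i → i ≤ j + m → B i = none) →
      progRun D c₀ prog x (m + 1) ≠ none) :
    ∃ I : Set (State K C × ℤ × (ℤ → Cell K C)),
      (∀ y ∈ I, ∃ z ∈ I, TransGen (AbsStep (rule D) State.dir) y z) ∧
      (.launch none, 0, input c₀ prog B) ∈ I := by
  refine ⟨{y | (∃ j, AtBlock c₀ prog B j y) ∨ ∃ j x m, InRun D c₀ prog B j x m y}, ?_,
    .inl ⟨0, atBlock_zero h0⟩⟩
  rintro y (⟨j, h⟩ | ⟨j, x, m, h⟩)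
  · obtain hB | ⟨_ | x, hB⟩ := Option.eq_none_or_eq_some (B j)
    · exact absurd hB h.1
    · exact absurd hB (hquit j)
    · obtain ⟨z, hz, h'⟩ := h.run hprog hB
      exact ⟨z, .inr ⟨j, x, 0, h'⟩, .single hz⟩
  · obtain ⟨z, hz, ⟨-, h'⟩ | h'⟩ := h.step hD hprog (hrun j x m h.1 h.2.1)
    · exact ⟨z, .inr ⟨j, x, m + 1, h'⟩, hz⟩
    · exact ⟨z, .inl ⟨_, h'⟩, hz⟩

/-- Every nonblank block is reached, unless the simulation halts before. -/
theorem reaches_block (hD : ∀ o c k c' e, D o true c = some (k, c', e) → e ≠ -1)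
    (hprog : ∀ x, 1 < (prog x).length) {J : ℕ} (hJ : B J ≠ none) (d : ℕ) :
    ∀ y, (AtBlock c₀ prog B (J - d) y ∧ d ≤ J ∨
        ∃ j x m, InRun D c₀ prog B j x m y ∧ j + m + d = J ∧ 0 < d) →
      ∃ z, ReflTransGen (AbsStep (rule D) State.dir) y z ∧
        (z.1 = .halted ∨ AtBlock c₀ prog B J z) := by
  -- `d` counts the blocks still missing up to `J`. A simulated step lowers it by one, but a launch
  -- does not; `key` isolates the simulated step so that a launch can be followed by one within the
  -- same induction step.
  have key : ∀ d, (∀ y, AtBlock c₀ prog B (J - d) y → d ≤ J →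
      ∃ z, ReflTransGen (AbsStep (rule D) State.dir) y z ∧
        (z.1 = .halted ∨ AtBlock c₀ prog B J z)) →
      ∀ y j x m, InRun D c₀ prog B j x m y → j + m + (d + 1) = J →
      (∀ y j x m, InRun D c₀ prog B j x m y → j + m + d = J → 0 < d →
        ∃ z, ReflTransGen (AbsStep (rule D) State.dir) y z ∧
        (z.1 = .halted ∨ AtBlock c₀ prog B J z)) →
      ∃ z, ReflTransGen (AbsStep (rule D) State.dir) y z ∧
        (z.1 = .halted ∨ AtBlock c₀ prog B J z) := by
    intro d hblock y j x m h e hrun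
    by_cases hm : progRun D c₀ prog x (m + 1) = none
    · obtain ⟨z, hz, hz'⟩ := h.halt hprog hm
      exact ⟨z, .single hz, .inl hz'⟩
    · obtain ⟨z, hz, ⟨hnext, h'⟩ | h'⟩ := h.step hD hprog hm
      · have hd : 0 < d := by
          by_contra h0
          exact hJ (by rw [← hnext]; congr 1; omega)
        obtain ⟨z', hz', hh⟩ := hrun z j x (m + 1) h' (by omega) hd
        exact ⟨z', hz.to_reflTransGen.trans hz', hh⟩
      · obtain ⟨z', hz', hh⟩ := hblock z (by rwa [show J - d = j + m + 1 by omega]) (by omega)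
        exact ⟨z', hz.to_reflTransGen.trans hz', hh⟩
  induction d with
  | zero =>
    rintro y (⟨h, -⟩ | ⟨j, x, m, -, -, h⟩)
    · exact ⟨y, .refl, .inr h⟩
    · omega
  | succ d ih =>
    have hrun : ∀ y j x m, InRun D c₀ prog B j x m y → j + m + (d + 1) = J →
        ∃ z, ReflTransGen (AbsStep (rule D) State.dir) y z ∧
          (z.1 = .halted ∨ AtBlock c₀ prog B J z) := fun y j x m h e =>
      key d (fun y hy hd => ih y (.inl ⟨hy, hd⟩)) y j x m h e
        fun y j x m h e hd => ih y (.inr ⟨j, x, m, h, e, hd⟩)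
    rintro y (⟨h, hd⟩ | ⟨j, x, m, h, e, -⟩)
    · obtain hB | ⟨_ | x, hB⟩ := Option.eq_none_or_eq_some (B (J - (d + 1)))
      · exact absurd hB h.1
      · obtain ⟨z, hz, hz'⟩ := h.quit hprog hB
        exact ⟨z, .single hz, .inl hz'⟩
      · obtain ⟨z, hz, h'⟩ := h.run (D := D) hprog hB
        obtain ⟨z', hz', hh⟩ := hrun z _ x 0 h' (by omega)
        exact ⟨z', .head hz hz', hh⟩
    · exact hrun y j x m h e

/-- A program that halts and is followed by blank blocks only makes the simulation halt. -/
theorem halts_of_run_none (hD : ∀ o c k c' e, D o true c = some (k, c', e) → e ≠ -1)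
    (hprog : ∀ x, 1 < (prog x).length) (hblank : ∀ i > j, B i = none) {n : ℕ}
    (hn : progRun D c₀ prog x (m + n) = none) (h : InRun D c₀ prog B j x m y) :
    ∃ z, ReflTransGen (AbsStep (rule D) State.dir) y z ∧ z.1 = .halted := by
  induction n generalizing m y with
  | zero =>
    obtain ⟨-, -, o, pos, w, τ, hrun, -⟩ := h
    rw [add_zero, hrun] at hn
    cases hn
  | succ n ih =>
    by_cases hm : progRun D c₀ prog x (m + 1) = none
    · obtain ⟨z, hz, hz'⟩ := h.halt hprog hm
      exact ⟨z, .single hz, hz'⟩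
    · obtain ⟨z, hz, ⟨-, h'⟩ | h'⟩ := h.step hD hprog hm
      · obtain ⟨z', hz', hh⟩ := ih (by rwa [add_assoc, add_comm 1]) h'
        exact ⟨z', hz.to_reflTransGen.trans hz', hh⟩
      · exact absurd (hblank (j + m + 1) (by omega)) h'.1

/-- The simulation halts if some block orders to halt, or if the last nonblank block is a program
that halts. -/
theorem exists_reaches_halted (hD : ∀ o c k c' e, D o true c = some (k, c', e) → e ≠ -1)
    (hprog : ∀ x, 1 < (prog x).length) (h0 : B 0 ≠ none)
    (hj : B j = some none ∨ (B j = some (some x) ∧ (∀ i > j, B i = none) ∧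
      ∃ n, progRun D c₀ prog x n = none)) :
    ∃ z, ReflTransGen (AbsStep (rule D) State.dir)
      (.launch none, 0, input c₀ prog B) z ∧ z.1 = .halted := by
  have hJ : B j ≠ none := by rcases hj with h | ⟨h, -⟩ <;> simp [h]
  obtain ⟨z, hz, hh | h⟩ := reaches_block (D := D) (c₀ := c₀) hD hprog hJ j _
    (.inl ⟨by rw [Nat.sub_self]; exact atBlock_zero h0, le_rfl⟩)
  · exact ⟨z, hz, hh⟩
  rcases hj with hB | ⟨hB, hblank, n, hn⟩
  · obtain ⟨z', hz', hh⟩ := h.quit hprog hB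
    exact ⟨z', hz.tail hz', hh⟩
  · obtain ⟨z', hz', h'⟩ := h.run (D := D) hprog hB
    obtain ⟨z'', hz'', hh⟩ := halts_of_run_none hD hprog hblank (m := 0) (by rwa [zero_add]) h'
    exact ⟨z'', (hz.tail hz').trans hz'', hh⟩

end

end HistorySim

/-! ### The search for the halting time as a partial recursive function -/

namespace TuringMachine

/-- The positions of the table entry that applies in the state number `q` at the symbol number
`a`. -/
def Description.lookup (d : Description) (q a : ℕ) : Option (ℕ × ℕ × ℕ × ℕ × ℤ) :=
  d.2.2.2.2.find? fun e => e.1 = q ∧ e.2.1 = a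

/-- The effect of a table entry on a configuration `(q, l, r)`, where `l` lists the symbols to the
left of the head, in the order of their distance, and `r` those from the head on. -/
def applyEntry (x : ℕ × List ℕ × List ℕ) (e : ℕ × ℕ × ℕ × ℕ × ℤ) : ℕ × List ℕ × List ℕ :=
  if e.2.2.2.2 = 1 then (e.2.2.1, e.2.2.2.1 :: x.2.1, x.2.2.tail)
  else if e.2.2.2.2 = -1 then (e.2.2.1, x.2.1.tail, x.2.1.headI :: e.2.2.2.1 :: x.2.2.tail)
  else (e.2.2.1, x.2.1, e.2.2.2.1 :: x.2.2.tail)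

/-- One step of the machine described by `d`; a halting configuration stays as it is. -/
def Description.step (d : Description) (x : ℕ × List ℕ × List ℕ) : ℕ × List ℕ × List ℕ :=
  if x.1 = d.2.2.2.1 then x
  else ((d.lookup x.1 x.2.2.headI).map (applyEntry x)).getD x

/-- The configuration with the initial state and the tape that carries the word `w`, of odd length,
around the head. -/
def Description.init (d : Description) (w : List ℕ) : ℕ × List ℕ × List ℕ :=
  (d.2.2.1, (w.take (w.length / 2)).reverse, w.drop (w.length / 2))

/-- The machine described by `d` halts within `s` steps on the tape that carries the word `w`. -/
def Description.haltsIn (d : Description) (w : List ℕ) (s : ℕ) : Bool :=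
  (d.step^[s] (d.init w)).1 = d.2.2.2.1

section Computability

open Primrec

theorem primrec_lookup : Primrec fun x : Description × ℕ × ℕ => x.1.lookup x.2.1 x.2.2 := by
  have htab : Primrec fun x : Description × ℕ × ℕ => x.1.2.2.2.2 :=
    snd.comp (snd.comp (snd.comp (snd.comp fst)))
  have hp : Primrec₂ fun (x : Description × ℕ × ℕ) (e : ℕ × ℕ × ℕ × ℕ × ℤ) =>
      decide (e.1 = x.2.1 ∧ e.2.1 = x.2.2) := by
    refine PrimrecPred.decide (PrimrecPred.and ?_ ?_)
    · exact Primrec.eq.comp (fst.comp snd) (fst.comp (snd.comp fst))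
    · exact Primrec.eq.comp (fst.comp (snd.comp snd)) (snd.comp (snd.comp fst))
  exact (list_getElem?.comp htab (list_findIdx htab hp)).of_eq fun x =>
    List.find?_eq_getElem?_findIdx.symm

theorem primrec_applyEntry : Primrec₂ applyEntry := by
  have hx1 : Primrec fun p : (ℕ × List ℕ × List ℕ) × (ℕ × ℕ × ℕ × ℕ × ℤ) => p.1.2.1 :=
    fst.comp (snd.comp fst)
  have hx2 : Primrec fun p : (ℕ × List ℕ × List ℕ) × (ℕ × ℕ × ℕ × ℕ × ℤ) => p.1.2.2.tail :=
    list_tail.comp (snd.comp (snd.comp fst))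
  have hq : Primrec fun p : (ℕ × List ℕ × List ℕ) × (ℕ × ℕ × ℕ × ℕ × ℤ) => p.2.2.2.1 :=
    fst.comp (snd.comp (snd.comp snd))
  have hb : Primrec fun p : (ℕ × List ℕ × List ℕ) × (ℕ × ℕ × ℕ × ℕ × ℤ) => p.2.2.2.2.1 :=
    fst.comp (snd.comp (snd.comp (snd.comp snd)))
  have he : Primrec fun p : (ℕ × List ℕ × List ℕ) × (ℕ × ℕ × ℕ × ℕ × ℤ) => p.2.2.2.2.2 :=
    snd.comp (snd.comp (snd.comp (snd.comp snd)))
  exact Primrec.ite (Primrec.eq.comp he (const 1)) (hq.pair ((list_cons.comp hb hx1).pair hx2))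
    (Primrec.ite (Primrec.eq.comp he (const (-1)))
      (hq.pair ((list_tail.comp hx1).pair
        (list_cons.comp (list_headI.comp hx1) (list_cons.comp hb hx2))))
      (hq.pair (hx1.pair (list_cons.comp hb hx2))))

theorem primrec_step : Primrec₂ Description.step := by
  have hq : Primrec fun p : Description × (ℕ × List ℕ × List ℕ) => p.2.1 := fst.comp snd
  have hh : Primrec fun p : Description × (ℕ × List ℕ × List ℕ) => p.1.2.2.2.1 :=
    fst.comp (snd.comp (snd.comp (snd.comp fst)))
  have hl : Primrec fun p : Description × (ℕ × List ℕ × List ℕ) =>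
      p.1.lookup p.2.1 p.2.2.2.headI := by
    have h : Primrec fun p : Description × (ℕ × List ℕ × List ℕ) => p.2.2.2.headI :=
      list_headI.comp (snd.comp (snd.comp snd))
    have := primrec_lookup.comp (fst.pair (hq.pair h))
    exact this
  have hg : Primrec₂ fun (p : Description × (ℕ × List ℕ × List ℕ))
      (e : ℕ × ℕ × ℕ × ℕ × ℤ) => applyEntry p.2 e := primrec_applyEntry.comp (snd.comp fst) snd
  have hm : Primrec fun p : Description × (ℕ × List ℕ × List ℕ) =>
      ((p.1.lookup p.2.1 p.2.2.2.headI).map (applyEntry p.2)).getD p.2 :=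
    option_getD.comp (option_map hl hg) snd
  unfold Description.step
  exact Primrec.ite (Primrec.eq.comp hq hh) snd hm

theorem primrec_haltsIn :
    Primrec fun x : (Description × List ℕ) × ℕ => x.1.1.haltsIn x.1.2 x.2 := by
  have hw : Primrec fun x : (Description × List ℕ) × ℕ => x.1.2 := snd.comp fst
  have hd : Primrec fun x : (Description × List ℕ) × ℕ => x.1.1 := fst.comp fst
  have hn : Primrec fun x : (Description × List ℕ) × ℕ => x.1.2.length / 2 :=
    nat_div.comp (list_length.comp hw) (const 2)
  have hs : Primrec fun x : (Description × List ℕ) × ℕ => x.1.1.2.2.1 :=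
    fst.comp (snd.comp (snd.comp hd))
  have hh : Primrec fun x : (Description × List ℕ) × ℕ => x.1.1.2.2.2.1 :=
    fst.comp (snd.comp (snd.comp (snd.comp hd)))
  have hi : Primrec fun x : (Description × List ℕ) × ℕ => x.1.1.init x.1.2 :=
    hs.pair ((list_reverse.comp (list_take.comp hn hw)).pair (list_drop.comp hn hw))
  have hit : Primrec fun x : (Description × List ℕ) × ℕ => x.1.1.step^[x.2] (x.1.1.init x.1.2) :=
    nat_iterate snd hi (primrec_step.comp (fst.comp (fst.comp fst)) snd)
  exact PrimrecPred.decide (Primrec.eq.comp (fst.comp hit) hh)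

/-- The least halting time of a machine on a word. -/
def haltingTime (x : Description × List ℕ) : Part ℕ :=
  Nat.rfind fun s => Part.some (x.1.haltsIn x.2 s)

/-- A function whose value at the code of a machine and a word is defined if the machine halts on
the word, and is then exponential in the halting time. -/
def haltingWitness : ℕ →. ℕ := fun n =>
  (Encodable.decode (α := Description × List ℕ) n : Part (Description × List ℕ)).bind fun x =>
    (haltingTime x).map fun s => 2 ^ (s + n + 2)

theorem primrec_two_pow : Primrec fun n : ℕ => 2 ^ n := by
  refine (Primrec.nat_rec₁ 1 (f := fun _ m => 2 * m) (nat_mul.comp (const 2) snd)).of_eq fun n => ?_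
  induction n with
  | zero => rfl
  | succ n ih => rw [pow_succ, mul_comm, ← ih]

theorem partrec_haltingWitness : Nat.Partrec haltingWitness := by
  rw [← Partrec.nat_iff]
  have h1 : Partrec fun p : ℕ × (Description × List ℕ) => haltingTime p.2 :=
    Partrec.rfind (p := fun (p : ℕ × (Description × List ℕ)) s =>
      Part.some (p.2.1.haltsIn p.2.2 s))
      (primrec_haltsIn.to_comp.comp ((Computable.snd.comp Computable.fst).pair Computable.snd)).partrec
  refine Partrec.bind (Computable.ofOption Computable.decode) (Partrec.map h1 ?_)
  refine (primrec_two_pow.comp (nat_add.comp (nat_add.comp snd (fst.comp fst)) (const 2))).to_comp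

end Computability

theorem haltsIn_of_mem_haltingWitness {d : Description} {w : List ℕ} {y : ℕ}
    (h : y ∈ haltingWitness (Encodable.encode (d, w))) :
    ∃ s, d.haltsIn w s = true ∧ y = 2 ^ (s + Encodable.encode (d, w) + 2) := by
  simp only [haltingWitness, Encodable.encodek, Part.coe_some, Part.bind_some, Part.mem_map_iff] at h
  obtain ⟨s, hs, rfl⟩ := h
  exact ⟨s, by simpa using Nat.rfind_spec hs, rfl⟩

theorem haltingWitness_dom {d : Description} {w : List ℕ} {s : ℕ} (h : d.haltsIn w s = true) :
    (haltingWitness (Encodable.encode (d, w))).Dom := by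
  simp only [haltingWitness, Encodable.encodek, Part.coe_some, Part.bind_some, Part.map_Dom,
    haltingTime]
  exact Nat.rfind_dom.2 ⟨s, by simpa using h, fun _ => trivial⟩

/-- One step of a machine; a halting configuration stays as it is. -/
noncomputable def totalStep (T : TuringMachine) (c : T.Config) : T.Config := (T.step c).getD c

/-- `T` halts within `n` steps on the input `t`. -/
def HaltsIn (T : TuringMachine) (t : T.Tape) (n : ℕ) : Prop :=
  (T.totalStep^[n] (T.start, t)).1 = T.halt

section Simulation

variable {T : TuringMachine}

theorem totalStep_of_halt {c : T.Config} (h : c.1 = T.halt) : T.totalStep c = c := by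
  simp [totalStep, step, h]

theorem totalStep_of_ne {c : T.Config} (h : c.1 ≠ T.halt) :
    T.totalStep c = T.globalTransition ⟨c, h⟩ := by
  simp [totalStep, step, h]

theorem HaltsIn.mono {t : T.Tape} {n m : ℕ} (h : T.HaltsIn t n) (hnm : n ≤ m) : T.HaltsIn t m := by
  obtain ⟨k, rfl⟩ := Nat.exists_eq_add_of_le' hnm
  rw [HaltsIn, Function.iterate_add_apply, Function.iterate_fixed (totalStep_of_halt h)]
  exact h

theorem halts_iff_haltsIn {t : T.Tape} : T.Halts t ↔ ∃ n, T.HaltsIn t n := by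
  constructor
  · rintro ⟨c, hc⟩
    obtain ⟨hr, hn⟩ := StateTransition.mem_eval.1 hc
    have : ∃ n, T.totalStep^[n] (T.start, t) = c := by
      clear hn hc
      induction hr with
      | refl => exact ⟨0, rfl⟩
      | tail _ hs ih =>
        obtain ⟨n, hn⟩ := ih
        refine ⟨n + 1, ?_⟩
        rw [Function.iterate_succ_apply', hn, totalStep, Option.mem_def.1 hs, Option.getD_some]
    obtain ⟨n, hn'⟩ := this
    exact ⟨n, by rw [HaltsIn, hn']; exact step_eq_none T hn⟩
  · rintro ⟨n, hn⟩
    refine ⟨T.totalStep^[n] (T.start, t), StateTransition.mem_eval.2 ⟨?_, ?_⟩⟩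
    · clear hn
      induction n with
      | zero => exact ReflTransGen.refl
      | succ n ih =>
        rw [Function.iterate_succ_apply']
        by_cases h : (T.totalStep^[n] (T.start, t)).1 = T.halt
        · rwa [totalStep_of_halt h]
        · refine ih.tail ?_
          rw [totalStep_of_ne h]
          simp [step, h]
    · have : T.totalStep^[n] (T.start, t) = (T.halt, (T.totalStep^[n] (T.start, t)).2) :=
        Prod.ext hn rfl
      rw [this]
      exact step_halt T _

/-- The head moves at most one cell per step, so `n` steps see only the cells up to distance `n`.
The margin `r` lets the induction pass through a shift of the tape. -/
theorem iterate_totalStep_congr {t t' : T.Tape} (n : ℕ) : ∀ r : ℕ,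
    (∀ i : ℤ, |i| ≤ n + r → t i = t' i) →
    (T.totalStep^[n] (T.start, t)).1 = (T.totalStep^[n] (T.start, t')).1 ∧
      ∀ i : ℤ, |i| ≤ r → (T.totalStep^[n] (T.start, t)).2 i =
        (T.totalStep^[n] (T.start, t')).2 i := by
  induction n with
  | zero => exact fun r h => ⟨rfl, fun i hi => h i (by simpa using hi)⟩
  | succ n ih =>
    intro r h
    obtain ⟨h1, h2⟩ := ih (r + 1) fun i hi => h i (by push_cast at hi ⊢; linarith)
    rw [Function.iterate_succ_apply', Function.iterate_succ_apply']
    set c := T.totalStep^[n] (T.start, t)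
    set c' := T.totalStep^[n] (T.start, t')
    by_cases hc : c.1 = T.halt
    · rw [totalStep_of_halt hc, totalStep_of_halt (h1 ▸ hc)]
      exact ⟨h1, fun i hi => h2 i (by push_cast; linarith)⟩
    · rw [totalStep_of_ne hc, totalStep_of_ne (h1 ▸ hc)]
      have h0 := h2 0 (by simp; positivity)
      simp only [globalTransition, ← h1, ← h0, true_and]
      intro i hi
      simp only [Function.update_apply]
      split_ifs with hi0
      · rfl
      · refine h2 _ ?_
        have : |((T.δ c.1 (c.2 0)).2.2 : ℤ)| ≤ 1 := by
          cases (T.δ c.1 (c.2 0)).2.2 <;> simp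
        push_cast
        exact (abs_add_le _ _).trans (add_le_add hi this)

theorem haltsIn_congr {t t' : T.Tape} {n : ℕ} (h : ∀ i : ℤ, |i| ≤ n → t i = t' i) :
    T.HaltsIn t n ↔ T.HaltsIn t' n := by
  rw [HaltsIn, HaltsIn, (iterate_totalStep_congr n 0 (by simpa using h)).1]

variable {k m : ℕ} (eQ : T.State ≃ Fin k) (eS : T.Symbol ≃ Fin m)

/-- A configuration and its numerical representation. -/
def Represents (c : T.Config) (x : ℕ × List ℕ × List ℕ) : Prop :=
  x.1 = eQ c.1 ∧ (∀ i : ℕ, (eS (c.2 i) : ℕ) = x.2.2.getD i 0) ∧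
    ∀ i : ℕ, (eS (c.2 (-1 - i)) : ℕ) = x.2.1.getD i 0

theorem description_lookup (q : T.State) (a : T.Symbol) :
    (T.description eQ eS).lookup (eQ q) (eS a) =
      some ((eQ q : ℕ), (eS a : ℕ), (eQ (T.δ q a).1 : ℕ), (eS (T.δ q a).2.1 : ℕ),
        ((T.δ q a).2.2 : ℤ)) := by
  rw [Description.lookup]
  have hmem : ((eQ q : ℕ), (eS a : ℕ), (eQ (T.δ q a).1 : ℕ), (eS (T.δ q a).2.1 : ℕ),
      ((T.δ q a).2.2 : ℤ)) ∈ (T.description eQ eS).2.2.2.2 := by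
    simp only [description, List.mem_flatMap, List.mem_map, List.mem_finRange, true_and]
    exact ⟨eQ q, eS a, by simp⟩
  cases hf : (T.description eQ eS).2.2.2.2.find? fun e => e.1 = (eQ q : ℕ) ∧ e.2.1 = (eS a : ℕ) with
  | none =>
    have := List.find?_eq_none.1 hf _ hmem
    simp at this
  | some e =>
    have h1 := List.find?_some hf
    have h2 := List.mem_of_find?_eq_some hf
    simp only [description, List.mem_flatMap, List.mem_map, List.mem_finRange, true_and] at h2
    obtain ⟨i, j, rfl⟩ := h2
    simp only [decide_eq_true_eq, Fin.val_inj] at h1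
    obtain ⟨rfl, rfl⟩ := h1
    simp

/-- The lists need not be long enough: `headI`, `tail` and `getD _ 0` all treat an exhausted list as
continued by `0`, the number of the blank. -/
theorem Represents.totalStep {c : T.Config} {x : ℕ × List ℕ × List ℕ}
    (h : Represents eQ eS c x) :
    Represents eQ eS (T.totalStep c) ((T.description eQ eS).step x) := by
  obtain ⟨h1, h2, h3⟩ := h
  obtain ⟨q, l, r⟩ := x
  obtain ⟨s, t⟩ := c
  simp only at h1 h2 h3
  subst h1
  by_cases hs : s = T.halt
  · subst hs
    rw [totalStep_of_halt rfl, Description.step,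
      if_pos (show ((eQ T.halt : ℕ), l, r).1 = (T.description eQ eS).2.2.2.1 from rfl)]
    exact ⟨rfl, h2, h3⟩
  have hne : ((eQ s : Fin k) : ℕ) ≠ eQ T.halt := by
    simpa [Fin.val_inj] using hs
  have hhead : r.headI = (eS (t 0) : ℕ) := by
    have := h2 0
    rw [Nat.cast_zero] at this
    rw [this]
    cases r <;> rfl
  rw [totalStep_of_ne (c := (s, t)) hs, Description.step,
    if_neg (show ¬((eQ s : ℕ), l, r).1 = (T.description eQ eS).2.2.2.1 from hne)]
  simp only [hhead, description_lookup, Option.map_some, Option.getD_some, globalTransition, applyEntry]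
  generalize T.δ s (t 0) = y
  obtain ⟨s', b, e⟩ := y
  have hr : ∀ i : ℕ, r.tail.getD i 0 = (eS (t (i + 1 : ℕ)) : ℕ) := by
    intro i
    rw [h2]
    cases r <;> simp
  have hl : ∀ i : ℕ, l.tail.getD i 0 = (eS (t (-1 - (i + 1 : ℕ))) : ℕ) := by
    intro i
    rw [h3]
    cases l <;> simp
  have hl0 : l.headI = (eS (t (-1)) : ℕ) := by
    have := h3 0
    rw [Nat.cast_zero, sub_zero] at this
    rw [this]
    cases l <;> rfl
  cases e with
  | pos =>
    refine ⟨rfl, fun i => ?_, fun i => ?_⟩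
    · simp only [SignType.pos_eq_one, SignType.coe_one, if_true, hr]
      rw [Function.update_of_ne (by omega)]
      rfl
    · simp only [SignType.pos_eq_one, SignType.coe_one, if_true]
      cases i with
      | zero => simp
      | succ i =>
        rw [Function.update_of_ne (by omega), List.getD_cons_succ, ← h3]
        congr 3
        push_cast; ring
  | neg =>
    refine ⟨rfl, fun i => ?_, fun i => ?_⟩
    · simp only [SignType.neg_eq_neg_one, SignType.coe_neg, SignType.coe_one]
      norm_num
      rcases i with _ | _ | i
      · simp [hl0]
      · simp
      · rw [Function.update_of_ne (by omega)]
        have := hr i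
        simp only [List.getD_eq_getElem?_getD] at this
        simp only [List.getElem?_cons_succ, this]
        congr 3
        push_cast; ring
    · simp only [SignType.neg_eq_neg_one, SignType.coe_neg, SignType.coe_one, if_true,
        show ((-1 : ℤ) = 1) = False by norm_num, if_false, hl]
      rw [Function.update_of_ne (by omega)]
      congr 3
      push_cast; ring
  | zero =>
    refine ⟨rfl, fun i => ?_, fun i => ?_⟩
    · simp only [SignType.zero_eq_zero, SignType.coe_zero, add_zero,
        show ((0 : ℤ) = 1) = False by norm_num, show ((0 : ℤ) = -1) = False by norm_num, if_false]
      cases i with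
      | zero => simp
      | succ i =>
        rw [Function.update_of_ne (by omega), List.getD_cons_succ, hr]
    · simp only [SignType.zero_eq_zero, SignType.coe_zero, add_zero,
        show ((0 : ℤ) = 1) = False by norm_num, show ((0 : ℤ) = -1) = False by norm_num, if_false]
      rw [Function.update_of_ne (by omega), h3]

theorem length_window (t : T.Tape) (r : ℕ) : (window eS t r).length = 2 * r + 1 := by
  simp [window]

theorem window_getD {t : T.Tape} {r i : ℕ} (hi : i ≤ 2 * r) (a : ℕ) :
    (window eS t r).getD i a = (eS (t ((i : ℤ) - r)) : ℕ) := by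
  have h : window eS t r = (List.range (2 * r + 1)).map fun j : ℕ => (eS (t ((j : ℤ) - r)) : ℕ) := by
    simp [window, ← List.map_eq_flatMap, Function.comp_def]
  rw [h, List.getD_eq_getElem _ _ (by simp; omega), List.getElem_map, List.getElem_range]

theorem getD_window (t : T.Tape) (r i : ℕ) (a : ℕ) : (window eS t r).getD i a =
    if i ≤ 2 * r then (eS (t ((i : ℤ) - r)) : ℕ) else a := by
  split_ifs with h
  · exact window_getD eS h a
  · rw [List.getD_eq_default _ _ (by rw [length_window]; omega)]

/-- Past its ends the word is read as blank, so the described machine runs on the blank extension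
`t'` of the window and not on `t`. -/
theorem haltsIn_window {t t' : T.Tape} {r : ℕ} (hin : ∀ i : ℤ, |i| ≤ r → t' i = t i)
    (hout : BlankOutside eS t' r) (n : ℕ) :
    (T.description eQ eS).haltsIn (window eS t r) n = true ↔ T.HaltsIn t' n := by
  have hlen : (window eS t r).length / 2 = r := by rw [length_window]; omega
  have hinit : Represents eQ eS (T.start, t')
      ((T.description eQ eS).init (window eS t r)) := by
    rw [Description.init, hlen]
    refine ⟨rfl, fun i => ?_, fun i => ?_⟩
    · have h := getD_window eS t r (r + i) 0
      simp only [List.getD_eq_getElem?_getD, List.getElem?_drop] at h ⊢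
      rw [h]
      split_ifs with hi
      · rw [hin i (by rw [abs_of_nonneg (by positivity)]; omega)]
        congr 3
        push_cast; ring
      · exact hout i (by rw [abs_of_nonneg (by positivity)]; omega)
    · by_cases hi : i < r
      · have h := getD_window eS t r (r - 1 - i) 0
        rw [if_pos (by omega)] at h
        have hr : ((window eS t r).take r).length = r := by
          rw [List.length_take, length_window]; omega
        simp only [List.getD_eq_getElem?_getD] at h ⊢
        rw [List.getElem?_reverse (by omega), hr, List.getElem?_take, if_pos (by omega), h,
          hin (-1 - i) (by rw [abs_le]; omega)]
        congr 3
        omega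
      · rw [List.getD_eq_default _ _ (by rw [List.length_reverse, List.length_take]; omega)]
        exact hout (-1 - i) (by rw [lt_abs]; omega)
  have hiter : ∀ n, Represents eQ eS (T.totalStep^[n] (T.start, t'))
      ((T.description eQ eS).step^[n] ((T.description eQ eS).init (window eS t r))) := by
    intro n
    induction n with
    | zero => exact hinit
    | succ n ih =>
      rw [Function.iterate_succ_apply', Function.iterate_succ_apply']
      exact ih.totalStep
  rw [Description.haltsIn, (hiter n).1, decide_eq_true_eq, HaltsIn]
  simp [description, Fin.val_inj]

end Simulation

end TuringMachine

/-! ### The explicit input and its computability -/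

namespace TuringMachine

open HistorySim

/-- The block number `j` of the input that simulates the machine described by `d`, where `w` is the
word at the positions `-j, …, j` of its tape. The block is blank if `w` has blank ends; it orders to
halt if the machine halts on `w` within `j` steps; otherwise it is the program that searches for
the halting time on `w`. -/
def Description.block (d : Description) (j : ℕ) (w : List ℕ) : Option (Option ℕ) :=
  if 0 < j ∧ w.headI = 0 ∧ w.getD (2 * j) 0 = 0 then none
  else if d.haltsIn w j = true then some none
  else some (some (Encodable.encode (d, w)))

section Computability

open Primrec

theorem primrec_block :
    Primrec fun x : (Description × List ℕ) × ℕ => x.1.1.block x.2 x.1.2 := by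
  have hw : Primrec fun x : (Description × List ℕ) × ℕ => x.1.2 := snd.comp fst
  have hlast : Primrec fun x : (Description × List ℕ) × ℕ => x.1.2.getD (2 * x.2) 0 := by
    have := (list_getD 0).comp hw (nat_mul.comp (const 2) snd)
    exact this
  have hp : PrimrecPred fun x : (Description × List ℕ) × ℕ =>
      0 < x.2 ∧ x.1.2.headI = 0 ∧ x.1.2.getD (2 * x.2) 0 = 0 :=
    (nat_lt.comp (const 0) snd).and
      ((Primrec.eq.comp (list_headI.comp hw) (const 0)).and (Primrec.eq.comp hlast (const 0)))
  have hh : PrimrecPred fun x : (Description × List ℕ) × ℕ => x.1.1.haltsIn x.1.2 x.2 = true :=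
    Primrec.eq.comp primrec_haltsIn (const true)
  have he : Primrec fun x : (Description × List ℕ) × ℕ => some (some (Encodable.encode x.1)) :=
    option_some.comp (option_some.comp (Primrec.encode.comp fst))
  unfold Description.block
  exact Primrec.ite hp (const none) (Primrec.ite hh (const (some none)) he)

theorem primrec_map_block {K C : Type} {c₀ : C} {prog : ℕ → List C}
    (hprim : ∀ enc : C → ℕ, Primrec fun x => (prog x).map enc) (hprog : ∀ x, 1 < (prog x).length)
    (enc : Cell K C → ℕ) : Primrec fun b => (HistorySim.block c₀ prog b).map enc := by
  have hcells : Primrec fun x => (progCells c₀ (prog x)).map enc := by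
    have h1 := list_headI.comp (hprim fun a => enc ⟨.first, a, false, .none, none⟩)
    have h2 := list_tail.comp (hprim fun a => enc (plainCell a))
    refine (list_cons.comp h1 (list_append.comp h2
      (const [enc ⟨.plain, c₀, true, .none, none⟩]))).of_eq fun x => ?_
    cases h : prog x with
    | nil => simpa [h] using hprog x
    | cons a l => simp [progCells]
  refine (option_casesOn (f := fun _ => [enc (plainCell c₀)])
    (g := fun _ o => Option.casesOn o [enc (quitCell c₀)] fun x => (progCells c₀ (prog x)).map enc)
    Primrec.id (const _)
    (option_casesOn snd (const _) (hcells.comp snd).to₂).to₂).of_eq fun b => ?_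
  rcases b with _ | _ | x <;> rfl

/-- The code of an integer is even exactly for `z ≥ 0`, and half of it is then `z`. -/
theorem primrec_int_toNat : Primrec Int.toNat := by
  refine (Primrec.ite (c := fun z : ℤ => Encodable.encode z % 2 = 0)
    (Primrec.eq.comp (nat_mod.comp Primrec.encode (const 2)) (const 0))
    (nat_div.comp Primrec.encode (const 2)) (const 0)).of_eq fun z => ?_
  cases z with
  | ofNat n =>
    have : Encodable.encode (Int.ofNat n) = 2 * n := rfl
    simp only [this]
    rw [if_pos (by omega), Int.ofNat_eq_natCast, Int.toNat_natCast]
    omega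
  | negSucc n =>
    have : Encodable.encode (Int.negSucc n) = 2 * n + 1 := rfl
    simp only [this]
    rw [if_neg (by omega)]
    rfl

theorem primrecPred_int_nonneg : PrimrecPred fun z : ℤ => 0 ≤ z := by
  refine (Primrec.eq.comp (nat_mod.comp Primrec.encode (const 2)) (const 0) :
    PrimrecPred fun z : ℤ => Encodable.encode z % 2 = 0).of_eq fun z => ?_
  cases z with
  | ofNat n =>
    have : Encodable.encode (Int.ofNat n) = 2 * n := rfl
    rw [this]
    simp only [Int.ofNat_eq_natCast, Int.natCast_nonneg, iff_true]
    omega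
  | negSucc n =>
    have : Encodable.encode (Int.negSucc n) = 2 * n + 1 := rfl
    simp only [this, Int.negSucc_not_nonneg, iff_false]
    omega

/-- The number of the symbol at the position `z` of the input, computed from the word at the
positions `-z, …, z` of the simulated tape. -/
def inputNumber {K C : Type} (c₀ : C) (prog : ℕ → List C) (enc : Cell K C → ℕ)
    (x : Description × ℤ × List ℕ) : ℕ :=
  if 0 ≤ x.2.1 then
    ((List.range (x.2.1.toNat + 1)).flatMap fun j => (HistorySim.block c₀ prog
      (x.1.block j ((x.2.2.drop (x.2.1.toNat - j)).take (2 * j + 1)))).map enc).getD x.2.1.toNat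
        (enc (plainCell c₀))
  else enc (plainCell c₀)

theorem primrec_inputNumber {K C : Type} {c₀ : C} {prog : ℕ → List C}
    (hprim : ∀ enc : C → ℕ, Primrec fun x => (prog x).map enc) (hprog : ∀ x, 1 < (prog x).length)
    (enc : Cell K C → ℕ) : Primrec (inputNumber c₀ prog enc) := by
  have hz : Primrec fun x : Description × ℤ × List ℕ => x.2.1 := fst.comp snd
  have hn : Primrec fun x : Description × ℤ × List ℕ => x.2.1.toNat := by
    have := primrec_int_toNat.comp hz
    exact this
  have hw : Primrec fun x : (Description × ℤ × List ℕ) × ℕ =>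
      (x.1.2.2.drop (x.1.2.1.toNat - x.2)).take (2 * x.2 + 1) := by
    have h1 : Primrec fun x : (Description × ℤ × List ℕ) × ℕ => x.1.2.2 := snd.comp (snd.comp fst)
    have h2 : Primrec fun x : (Description × ℤ × List ℕ) × ℕ => x.1.2.1.toNat - x.2 := by
      have := nat_sub.comp (hn.comp fst) (snd (α := Description × ℤ × List ℕ) (β := ℕ))
      exact this
    have h3 : Primrec fun x : (Description × ℤ × List ℕ) × ℕ => 2 * x.2 + 1 :=
      nat_add.comp (nat_mul.comp (const 2) snd) (const 1)
    have := list_take.comp h3 (list_drop.comp h2 h1)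
    exact this
  have hb : Primrec₂ fun (x : Description × ℤ × List ℕ) (j : ℕ) => (HistorySim.block c₀ prog
      (x.1.block j ((x.2.2.drop (x.2.1.toNat - j)).take (2 * j + 1)))).map enc := by
    have h1 : Primrec fun x : (Description × ℤ × List ℕ) × ℕ => x.1.1 := fst.comp fst
    have := (primrec_map_block (c₀ := c₀) hprim hprog enc).comp (primrec_block.comp ((h1.pair hw).pair snd))
    exact this
  have hl := list_flatMap (list_range.comp (succ.comp hn)) hb
  have hg := (list_getD (enc (plainCell c₀))).comp hl hn
  have hp : PrimrecPred fun x : Description × ℤ × List ℕ => 0 ≤ x.2.1 := by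
    have := primrecPred_int_nonneg.comp hz
    exact this
  have := Primrec.ite hp hg (const (enc (plainCell c₀)))
  exact this

/-- A bound on the size of the input that simulates the machine described by `d` on a tape that is
blank outside `-N, …, N`. -/
def inputBound (x : Description × ℕ) : ℕ :=
  (x.2 + 1) * (Encodable.encode (x.1, List.replicate (2 * x.2 + 1) x.1.2.1) + 3)

theorem primrec_inputBound : Primrec inputBound := by
  have h1 : Primrec fun x : Description × ℕ => 2 * x.2 + 1 :=
    nat_add.comp (nat_mul.comp (const 2) snd) (const 1)
  have h2 : Primrec₂ fun (x : Description × ℕ) (_ : ℕ) => x.1.2.1 :=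
    (fst.comp (snd.comp (fst.comp fst))).to₂
  have h3 : Primrec fun x : Description × ℕ => List.replicate (2 * x.2 + 1) x.1.2.1 :=
    (list_map (list_range.comp h1) h2).of_eq fun x => by simp
  have := nat_mul.comp (succ.comp (snd (α := Description) (β := ℕ)))
    (nat_add.comp (Primrec.encode.comp (fst.pair h3)) (const 3))
  exact this

end Computability

theorem pair_le_pair {a b c d : ℕ} (h : a ≤ c) (h' : b ≤ d) : Nat.pair a b ≤ Nat.pair c d := by
  refine le_trans (b := Nat.pair c b) ?_ ?_
  · rcases h.lt_or_eq with h | rfl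
    · exact (Nat.pair_lt_pair_left b h).le
    · exact le_rfl
  · rcases h'.lt_or_eq with h | rfl
    · exact (Nat.pair_lt_pair_right c h).le
    · exact le_rfl

/-- Pairing is monotone in both arguments, so the code of a list is largest when length and entries
are. This bounds the numbers, and hence the lengths, of the programs in the input. -/
theorem encode_list_le_replicate {w : List ℕ} {n m : ℕ} (hn : w.length ≤ n)
    (hm : ∀ a ∈ w, a ≤ m) : Encodable.encode w ≤ Encodable.encode (List.replicate n m) := by
  induction w generalizing n with
  | nil => exact Nat.zero_le _
  | cons a w ih =>
    obtain ⟨n, rfl⟩ := Nat.exists_eq_succ_of_ne_zero (show n ≠ 0 by rintro rfl; simp at hn)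
    rw [List.replicate_succ, Encodable.encode_list_cons, Encodable.encode_list_cons]
    exact Nat.succ_le_succ (pair_le_pair (hm a (by simp))
      (ih (by simpa using hn) fun b hb => hm b (by simp [hb])))

section Window

variable {T : TuringMachine} {k m : ℕ} (eQ : T.State ≃ Fin k) (eS : T.Symbol ≃ Fin m)

theorem window_lt {t : T.Tape} {r a : ℕ} (ha : a ∈ window eS t r) : a < m := by
  simp only [window, List.mem_map] at ha
  obtain ⟨j, -, rfl⟩ := ha
  exact (eS _).2

theorem window_take_drop (t : T.Tape) {i j : ℕ} (h : j ≤ i) :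
    ((window eS t i).drop (i - j)).take (2 * j + 1) = window eS t j := by
  refine List.ext_getElem? fun a => ?_
  have h1 := getD_window eS t i (i - j + a) 0
  have h2 := getD_window eS t j a 0
  rw [List.getElem?_take, List.getElem?_drop]
  split_ifs with ha
  · rw [List.getElem?_eq_getElem (by rw [length_window]; omega),
      List.getElem?_eq_getElem (by rw [length_window]; omega)]
    rw [List.getD_eq_getElem _ _ (by rw [length_window]; omega), if_pos (by omega)] at h1 h2
    rw [h1, h2]
    congr 4
    omega
  · rw [List.getElem?_eq_none (by rw [length_window]; omega)]

/-- The blocks of the input that simulates `T` on the tape `t`. -/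
def tapeBlock (t : T.Tape) (j : ℕ) : Option (Option ℕ) :=
  (T.description eQ eS).block j (window eS t j)

theorem inputNumber_window {K C : Type} (c₀ : C) (prog : ℕ → List C) (enc : Cell K C → ℕ)
    (t : T.Tape) (z : ℤ) :
    inputNumber c₀ prog enc (T.description eQ eS, z, window eS t z.toNat) =
      enc (input c₀ prog (tapeBlock eQ eS t) z) := by
  rw [inputNumber, input]
  dsimp only
  split_ifs with hz
  · rw [List.getD_eq_getElem?_getD, List.getD_eq_getElem?_getD, ← Option.getD_map (f := enc),
      ← List.getElem?_map, List.map_flatMap]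
    congr 2
    refine List.flatMap_congr fun j hj => ?_
    rw [window_take_drop eS t (by rw [List.mem_range] at hj; omega)]
    rfl
  · rfl

theorem tapeBlock_eq_none {t : T.Tape} {j : ℕ} : tapeBlock eQ eS t j = none ↔
    0 < j ∧ (eS (t (-j)) : ℕ) = 0 ∧ (eS (t j) : ℕ) = 0 := by
  have h1 : (window eS t j).headI = (eS (t (-j)) : ℕ) := by
    have := getD_window eS t j 0 0
    rw [if_pos (by omega), Nat.cast_zero, zero_sub] at this
    rw [← this]
    cases window eS t j <;> rfl
  have h2 : (window eS t j).getD (2 * j) 0 = (eS (t j) : ℕ) := by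
    rw [getD_window, if_pos le_rfl]
    congr 3
    push_cast; ring
  rw [tapeBlock, Description.block, h1, h2]
  split_ifs <;> simp_all

theorem tapeBlock_eq_some {t : T.Tape} {j : ℕ} {o : Option ℕ} (h : tapeBlock eQ eS t j = some o) :
    o = if (T.description eQ eS).haltsIn (window eS t j) j = true then none
      else some (Encodable.encode (T.description eQ eS, window eS t j)) := by
  rw [tapeBlock, Description.block] at h
  split_ifs at h ⊢ <;> simp_all

end Window

end TuringMachine

/-! ### Halting of `T` against halting of the simulation -/

namespace TuringMachine

open HistorySim

section Correctness

theorem exists_of_runFor_eq_none {σ : Type} {f : σ → Option σ} {a : σ} {n : ℕ}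
    (h : runFor f a (n + 1) = none) : ∃ i ≤ n, ∃ b, runFor f a i = some b ∧ f b = none := by
  induction n with
  | zero => exact ⟨0, le_rfl, a, rfl, h⟩
  | succ n ih =>
    cases hn : runFor f a (n + 1) with
    | none =>
      obtain ⟨i, hi, hb⟩ := ih hn
      exact ⟨i, hi.trans (Nat.le_succ n), hb⟩
    | some b =>
      rw [runFor, hn] at h
      exact ⟨n + 1, le_rfl, b, hn, h⟩

variable {T : TuringMachine} {k m : ℕ} (eQ : T.State ≃ Fin k) (eS : T.Symbol ≃ Fin m)

theorem exists_blank_extension (t : T.Tape) (j : ℕ) :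
    ∃ t' : T.Tape, (∀ i : ℤ, |i| ≤ j → t' i = t i) ∧ BlankOutside eS t' j := by
  have hm : 0 < m := (Nat.zero_le _).trans_lt (eS (t 0)).2
  refine ⟨fun i => if |i| ≤ j then t i else eS.symm ⟨0, hm⟩, fun i hi => if_pos hi, fun i hi => ?_⟩
  simp [not_le.2 hi]

theorem tapeBlock_zero_ne_none (t : T.Tape) : tapeBlock eQ eS t 0 ≠ none := by
  simp [tapeBlock_eq_none]

/-- A blank block `i` says that `t` is blank at `-i` and `i`. A run of blank blocks after block `j`
thus certifies that the blank extension of the window is still the true tape. -/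
theorem eq_of_tapeBlock_eq_none {t t' : T.Tape} {j n : ℕ}
    (hin : ∀ i : ℤ, |i| ≤ j → t' i = t i) (hout : BlankOutside eS t' j)
    (h : ∀ i, j < i → i ≤ n → tapeBlock eQ eS t i = none) (i : ℤ) (hi : |i| ≤ n) : t' i = t i := by
  rcases le_or_gt |i| j with hj | hj
  · exact hin i hj
  · have hij : j < i.natAbs ∧ i.natAbs ≤ n := by
      rw [← Int.natCast_natAbs] at hj hi
      omega
    obtain ⟨-, h1, h2⟩ := (tapeBlock_eq_none eQ eS).1 (h i.natAbs hij.1 hij.2)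
    refine eS.injective (Fin.val_injective ((hout i hj).trans ?_))
    rcases abs_cases i with ⟨hi', -⟩ | ⟨hi', -⟩
    · rw [← h2, Int.natCast_natAbs, hi']
    · rw [← h1, Int.natCast_natAbs, hi', neg_neg]

variable {K C : Type} {c₀ : C} {D : Option K → Bool → C → Option (K × C × SignType)}
  {prog : ℕ → List C} {t : T.Tape}

/-- Let `T` halt in `s` steps. A nonblank block `j ≥ s` contains every cell visited and orders to
halt. If there is none, the last nonblank block, which exists because block `0` is never blank, has
the whole of `t` in its window up to blanks. -/
theorem exists_halting_block
    (hg : ∀ x, (haltingWitness x).Dom → ∃ n, progRun D c₀ prog x n = none) (h : T.Halts t) :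
    ∃ j x, tapeBlock eQ eS t j = some none ∨ tapeBlock eQ eS t j = some (some x) ∧
      (∀ i > j, tapeBlock eQ eS t i = none) ∧ ∃ n, progRun D c₀ prog x n = none := by
  obtain ⟨s, hs⟩ := halts_iff_haltsIn.1 h
  by_cases hfar : ∃ j ≥ s, tapeBlock eQ eS t j ≠ none
  · obtain ⟨j, hj, hB⟩ := hfar
    obtain ⟨o, ho⟩ := Option.ne_none_iff_exists'.1 hB
    obtain ⟨t', hin, hout⟩ := exists_blank_extension eS t j
    have hhalt : (T.description eQ eS).haltsIn (window eS t j) j = true :=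
      (haltsIn_window eQ eS hin hout j).2
        (((haltsIn_congr fun i hi => (hin i (hi.trans (by exact_mod_cast hj))).symm).1 hs).mono hj)
    refine ⟨j, 0, .inl ?_⟩
    rw [ho, tapeBlock_eq_some eQ eS ho, if_pos hhalt]
  · push Not at hfar
    obtain ⟨j, hj, hlast⟩ : ∃ j, tapeBlock eQ eS t j ≠ none ∧
        ∀ i > j, tapeBlock eQ eS t i = none := by
      classical
      refine ⟨Nat.findGreatest (fun j => tapeBlock eQ eS t j ≠ none) s,
        Nat.findGreatest_spec (P := fun j => tapeBlock eQ eS t j ≠ none) (Nat.zero_le s)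
          (tapeBlock_zero_ne_none eQ eS t), fun i hi => ?_⟩
      rcases le_or_gt i s with his | his
      · exact not_not.1 (Nat.findGreatest_is_greatest hi his)
      · exact hfar i his.le
    obtain ⟨o, ho⟩ := Option.ne_none_iff_exists'.1 hj
    obtain ⟨t', hin, hout⟩ := exists_blank_extension eS t j
    have ht : t' = t := funext fun i =>
      eq_of_tapeBlock_eq_none eQ eS (n := i.natAbs) hin hout (fun i hi _ => hlast i hi) i (by simp)
    have hhalt : (T.description eQ eS).haltsIn (window eS t j) s = true :=
      (haltsIn_window eQ eS hin hout s).2 (ht ▸ hs)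
    refine ⟨j, Encodable.encode (T.description eQ eS, window eS t j), ?_⟩
    rw [ho, tapeBlock_eq_some eQ eS ho]
    split_ifs
    · exact .inl rfl
    · exact .inr ⟨rfl, hlast, hg _ (haltingWitness_dom hhalt)⟩

/-- An order to halt is issued only after `j` steps on the window of radius `j`, and so many steps
cannot leave the window. -/
theorem tapeBlock_ne_of_not_halts (h : ¬ T.Halts t) (j : ℕ) :
    tapeBlock eQ eS t j ≠ some none := by
  intro hB
  have hhalt := tapeBlock_eq_some eQ eS hB
  obtain ⟨t', hin, hout⟩ := exists_blank_extension eS t j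
  split_ifs at hhalt with h'
  exact h (halts_iff_haltsIn.2 ⟨j,
    (haltsIn_congr hin).1 ((haltsIn_window eQ eS hin hout j).1 h')⟩)

/-- If the program stops after `a ≤ n` steps, its value `2 ^ (s + x + 2)` is less than `2 ^ (a +
(prog x).length)`. As the program has at most `x + 2` cells, `s < a`. The `n` blank blocks make `t`
agree with the blank extension far enough for `s` steps, so `T` itself would halt. -/
theorem progRun_ne_none_of_not_halts (hlen : ∀ x, (prog x).length ≤ x + 2)
    (hg : ∀ x n z, progRun D c₀ prog x n = some z → oneSidedStep D z = none →
      ∃ y ∈ haltingWitness x, y < 2 ^ (n + (prog x).length)) (h : ¬ T.Halts t) {j x n : ℕ}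
    (hB : tapeBlock eQ eS t j = some (some x))
    (hblank : ∀ i, j < i → i ≤ j + n → tapeBlock eQ eS t i = none) :
    progRun D c₀ prog x (n + 1) ≠ none := by
  intro hnone
  obtain ⟨a, han, z, hz, hquit⟩ : ∃ a ≤ n, ∃ z, progRun D c₀ prog x a = some z ∧
      oneSidedStep D z = none := exists_of_runFor_eq_none hnone
  obtain ⟨y, hy, hlt⟩ := hg x a z hz hquit
  have hx := tapeBlock_eq_some eQ eS hB
  split_ifs at hx
  obtain rfl := Option.some_injective _ hx
  obtain ⟨s, hs, rfl⟩ := haltsIn_of_mem_haltingWitness hy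
  have hsa : s < a := by
    have := (Nat.pow_lt_pow_iff_right (by norm_num)).1 hlt
    have := hlen (Encodable.encode (T.description eQ eS, window eS t j))
    omega
  obtain ⟨t', hin, hout⟩ := exists_blank_extension eS t j
  refine h (halts_iff_haltsIn.2 ⟨s, (haltsIn_congr fun i hi => ?_).1
    ((haltsIn_window eQ eS hin hout s).1 hs)⟩)
  exact eq_of_tapeBlock_eq_none eQ eS hin hout hblank i (by push_cast; omega)

/-- A program block has at most `x + 2` cells and the front, whence the `3` in `inputBound`. The
word of `2 * N + 1` symbols `m` has a code at least as large as every window of radius at most `N`,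
whose entries are below `m`. -/
theorem offset_tapeBlock_le (hprog : ∀ x, 1 < (prog x).length)
    (hlen : ∀ x, (prog x).length ≤ x + 2) (N : ℕ) :
    offset (K := K) c₀ prog (tapeBlock eQ eS t) (N + 1) ≤
      inputBound (T.description eQ eS, N) := by
  have hblock : ∀ j ≤ N, (HistorySim.block (K := K) c₀ prog (tapeBlock eQ eS t j)).length ≤
      Encodable.encode (T.description eQ eS, List.replicate (2 * N + 1) m) + 3 := by
    intro j hj
    rcases hB : tapeBlock eQ eS t j with _ | _ | x
    · simp [HistorySim.block]
    · simp [HistorySim.block]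
    · have hx := tapeBlock_eq_some eQ eS hB
      split_ifs at hx
      obtain rfl := Option.some_injective _ hx
      rw [HistorySim.block, length_progCells c₀ (zero_lt_one.trans (hprog _))]
      refine Nat.succ_le_succ ((hlen _).trans (Nat.add_le_add_right ?_ 2))
      have hle : Encodable.encode (window eS t j) ≤
          Encodable.encode (List.replicate (2 * N + 1) m) :=
        encode_list_le_replicate (by rw [length_window]; omega) fun a ha => (window_lt eS ha).le
      exact pair_le_pair le_rfl hle
  have hoff : ∀ j ≤ N + 1, offset (K := K) c₀ prog (tapeBlock eQ eS t) j ≤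
      j * (Encodable.encode (T.description eQ eS, List.replicate (2 * N + 1) m) + 3) := by
    intro j
    induction j with
    | zero => exact fun _ => (offset_zero (K := K)).le.trans (Nat.zero_le _)
    | succ j ih =>
      intro hj
      rw [offset_succ, Nat.succ_mul]
      exact add_le_add (ih (by omega)) (hblock j (by omega))
  exact hoff _ le_rfl

theorem input_tapeBlock_of_blankOutside (hprog : ∀ x, 1 < (prog x).length)
    (hlen : ∀ x, (prog x).length ≤ x + 2) {N : ℕ} (ht : BlankOutside eS t N) {i : ℤ}
    (hi : (inputBound (T.description eQ eS, N) : ℤ) < |i|) :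
    input (K := K) c₀ prog (tapeBlock eQ eS t) i = plainCell c₀ := by
  rcases lt_or_ge i 0 with h | h
  · rw [input, if_neg (not_le.2 h)]
  · have hle := offset_tapeBlock_le (K := K) (c₀ := c₀) (t := t) eQ eS hprog hlen N
    rw [abs_of_nonneg h] at hi
    obtain ⟨a, ha⟩ := Int.eq_ofNat_of_zero_le
      (show 0 ≤ i - (offset (K := K) c₀ prog (tapeBlock eQ eS t) (N + 1) : ℕ) by omega)
    have hnone : ∀ b, N < b → tapeBlock eQ eS t b = none := fun b hb =>
      (tapeBlock_eq_none eQ eS).2 ⟨by omega, ht _ (by simpa using hb), ht _ (by simpa using hb)⟩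
    have hoff := offset_add_of_none (K := K) (c₀ := c₀) (prog := prog) (B := tapeBlock eQ eS t)
      (j := N + 1) (m := a) fun b hb _ => hnone b hb
    rw [show i = (offset (K := K) c₀ prog (tapeBlock eQ eS t) (N + 1 + a) : ℕ) by
      rw [hoff]; push_cast; omega]
    exact input_of_none hprog (hnone _ (by omega))

end Correctness

instance {K C : Type} [Nonempty C] : Nontrivial (Cell K C) :=
  ⟨⟨⟨.plain, Classical.arbitrary C, true, .none, none⟩,
    ⟨.plain, Classical.arbitrary C, false, .none, none⟩, by simp⟩⟩

end TuringMachine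

/-! ### The universal machine -/

open TuringMachine HistorySim

theorem mainTheorem2 :
    ∃ T' : TuringMachine,
      T'.Reversible ∧
      (∀ (q : T'.State) (a : T'.Symbol), (T'.δ q a).1 ≠ T'.start) ∧
      T'.Restart ∧
      T'.Universal := by
  obtain ⟨K, C, _, _, c₀, D, prog, hD, hprim, hlen, hrun⟩ :=
    exists_oneSided_of_partrec partrec_haltingWitness
  have hprog : ∀ x, 1 < (prog x).length := fun x => (hlen x).1
  have hlen' : ∀ x, (prog x).length ≤ x + 2 := fun x => (hlen x).2
  have : Nonempty C := ⟨c₀⟩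
  obtain ⟨M, hrev, hstart, hrestart, e, he⟩ := exists_restart_machine (rule D) State.dir
    (.launch none) .halted (rule_injective D) (rule_ne_launch_none D) (fun _ => rfl) rfl
  refine ⟨M, hrev, hstart, hrestart, ?_⟩
  have := M.finSymbol
  let e₁ : M.Symbol ≃ Fin (Nat.card M.Symbol) := Finite.equivFin _
  have hpos : 0 < Nat.card M.Symbol := Nat.zero_le _ |>.trans_lt (e₁ (e.symm (plainCell c₀))).2
  -- The swap gives the plain blank cell the number `0`, so that it is the blank symbol of `M`.
  let eU : M.Symbol ≃ Fin (Nat.card M.Symbol) :=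
    e₁.trans (Equiv.swap (e₁ (e.symm (plainCell c₀))) ⟨0, hpos⟩)
  have hblank : (eU (e.symm (plainCell c₀)) : ℕ) = 0 := by simp [eU]
  refine ⟨Nat.card M.Symbol, eU, fun x => x.2.toNat, inputNumber c₀ prog fun c => eU (e.symm c),
    inputBound, (primrec_int_toNat.comp Primrec.snd).to_comp,
    (primrec_inputNumber hprim hprog _).to_comp, primrec_inputBound.to_comp, ?_⟩
  intro T k m eQ eS t
  refine ⟨fun n => e.symm (input c₀ prog (tapeBlock eQ eS t) n), fun n => ?_, fun N hN i hi => ?_,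
    fun h => ?_, fun h => ?_⟩
  · exact (inputNumber_window eQ eS c₀ prog (fun c => (eU (e.symm c) : ℕ)) t n).symm
  · dsimp only
    rw [input_tapeBlock_of_blankOutside eQ eS hprog hlen' hN hi, hblank]
  · obtain ⟨j, x, hj⟩ := exists_halting_block eQ eS (D := D) (c₀ := c₀) (prog := prog)
      (fun x => (hrun x).1) h
    exact (he _).1 (exists_reaches_halted (j := j) hD hprog (tapeBlock_zero_ne_none eQ eS t) hj)
  · by_contra hT
    obtain ⟨I, hI, hmem⟩ := exists_invariant hD hprog (tapeBlock_zero_ne_none eQ eS t)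
      (tapeBlock_ne_of_not_halts eQ eS hT) fun j x n hB hb =>
        progRun_ne_none_of_not_halts eQ eS hlen' (fun x => (hrun x).2) hT hB hb
    exact (he _).2 I hI hmem h
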